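/- Let $N\ge 1$ be an integer, let $V=\{1,\dots,N,\delta\}$, and let $W=(W_{ij})_{i,j\in V}$ be symmetric positive edge weights, $W_{ij}=W_{ji}>0$. For $t=(t_1,\dots,t_N)\in\mathbb{R}^N$ put $t_\delta=0$ and $$\mathcal{D}_W(t)=\sum_{T}\ \prod_{(ij)\in T}W_{ij}\,e^{t_i+t_j},$$ where $T$ runs over the spanning trees of the complete graph on $V$. The effective $t$-field of the $H^{2|2}$ model pinned at $\delta$ is the measure on $\mathbb{R}^N$ $$d\nu_\delta(t)=\exp\Bigl(-\tfrac12\sum_{i,j\in V}W_{ij}\bigl(\cosh(t_i-t_j)-1\bigr)\Bigr)\sqrt{\mathcal{D}_W(t)}\ \prod_{i=1}^N\frac{e^{-t_i}\,dt_i}{\sqrt{2\pi}}.$$ Let $F:\mathbb{R}^N\to\mathbb{R}$ be smooth and jointly convex (equivalently, smooth with positive semidefinite Hessian everywhere). Then the negative part of $t\mapsto F(e^{t_1},\dots,e^{t_N})$ has finite integral with respect to $\nu_\delta$, so that the integral $$\int_{\mathbb{R}^N} F(e^{t_1},\dots,e^{t_N})\,d\nu_\delta(t)\in(-\infty,+\infty]$$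 is well defined, and this integral is non-increasing in each of the edge weights $W_{ij}\in(0,\infty)$, $i,j\in\{1,\dots,N,\delta\}$, the other weights being fixed. -/

import Mathlib

open MeasureTheory
open scoped ENNReal ContDiff

noncomputable section

namespace H22

/-- The vertex set `V = {1, …, N, δ}`; the root `δ` is `none` and the vertex `i` is `some i`. -/
abbrev Vertex (N : ℕ) : Type := Option (Fin N)

/-- Symmetric edge weights `W i j = W j i`, as a function on unordered pairs of vertices. -/
abbrev Weights (N : ℕ) : Type := Sym2 (Vertex N) → ℝ

/-- All the weights of edges between distinct vertices are positive. -/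
def Weights.IsPositive {N : ℕ} (W : Weights N) : Prop :=
  ∀ a b : Vertex N, a ≠ b → 0 < W s(a, b)

/-- The extension of `t = (t_1, …, t_N)` to all of `V` with the pinning `t_δ = 0`. -/
def pin {N : ℕ} (t : Fin N → ℝ) : Vertex N → ℝ
  | none => 0
  | some i => t i

/-- The factor `W_{ij} e^{t_i + t_j}` of the edge `(ij)`. -/
def edgeFactor {N : ℕ} (W : Weights N) (t : Fin N → ℝ) (e : Sym2 (Vertex N)) : ℝ :=
  W e * Sym2.lift ⟨fun a b => Real.exp (pin t a + pin t b),
    fun a b => by simp only [add_comm]⟩ e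

open Classical in
/-- `𝒟_W(t) = ∑_T ∏_{(ij) ∈ T} W_{ij} e^{t_i + t_j}`, the sum over the spanning trees `T` of the
complete graph on `V`, that is, over the trees with vertex set `V`. -/
def treeSum {N : ℕ} (W : Weights N) (t : Fin N → ℝ) : ℝ :=
  ∑ T : SimpleGraph (Vertex N) with T.IsTree,
    ∏ e : Sym2 (Vertex N) with e ∈ T.edgeSet, edgeFactor W t e

/-- The density of the effective `t`-field with respect to Lebesgue measure:
`exp (-1/2 ∑_{i,j ∈ V} W_{ij} (cosh (t_i - t_j) - 1)) √(𝒟_W(t)) ∏_i e^{-t_i} / √(2π)`. -/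
def density {N : ℕ} (W : Weights N) (t : Fin N → ℝ) : ℝ :=
  Real.exp (-(1 / 2 * ∑ a : Vertex N, ∑ b : Vertex N,
      W s(a, b) * (Real.cosh (pin t a - pin t b) - 1)))
    * Real.sqrt (treeSum W t)
    * ∏ i : Fin N, (Real.exp (-t i) / Real.sqrt (2 * Real.pi))

/-- The effective `t`-field measure `ν_δ` of the `H^{2|2}` model pinned at `δ`. -/
def tField {N : ℕ} (W : Weights N) : Measure (Fin N → ℝ) :=
  (volume : Measure (Fin N → ℝ)).withDensity fun t => ENNReal.ofReal (density W t)

/-- The integral of a real function as an extended real number: the integral of the positive part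
minus the integral of the negative part. It is meaningful if one of the two is finite. -/
def extIntegral {X : Type*} [MeasurableSpace X] (μ : Measure X) (g : X → ℝ) : EReal :=
  ((∫⁻ x, ENNReal.ofReal (g x) ∂μ : ℝ≥0∞) : EReal)
    - ((∫⁻ x, ENNReal.ofReal (-g x) ∂μ : ℝ≥0∞) : EReal)

/-- For an integrable function, the extended integral is the usual one. -/
theorem extIntegral_eq_integral {X : Type*} [MeasurableSpace X] {μ : Measure X} {g : X → ℝ}
    (hg : Integrable g μ) : extIntegral μ g = ((∫ x, g x ∂μ : ℝ) : EReal) := by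
  have h1 : ∫⁻ x, ENNReal.ofReal (g x) ∂μ ≠ ⊤ := hg.lintegral_lt_top.ne
  have h2 : ∫⁻ x, ENNReal.ofReal (-g x) ∂μ ≠ ⊤ := hg.neg.lintegral_lt_top.ne
  rw [integral_eq_lintegral_pos_part_sub_lintegral_neg_part hg, EReal.coe_sub, extIntegral,
    EReal.coe_ennreal_toReal h1, EReal.coe_ennreal_toReal h2]

end H22

end

/-! The proof isolates one edge, conditions on the rest of the field, and reduces to a field with a
single edge, where the law is explicit.

Take the edge between a vertex 0 and the root, put τ = t_0, and replace the remaining coordinates t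
by the potential β that makes e^t solve H_β e^t = ρ + e^τ η. Here ρ and η are the weights from the
bulk to the root and to 0, and H_β = diag β - A, with A the matrix of bulk weights. The range of β
is a set of potentials that depends neither on τ nor on the weight of the edge. By the matrix-tree
theorem (`det_redLaplacian`) and a Schur complement (`treeSum_cons`), the density becomes a function
of β times the density of τ on a single edge of weight r = W_{0δ} + C(β), where C(β) is the
conductance through the bulk (`density_cons`). Given β, every e^{t_k} is affine in e^τ
(`exp_eq_green`), so a convex F restricts to a convex function of y = e^τ. The weight W_{0δ} enters
only through r.

On a single edge, z = 2√r sinh(τ/2) turns the symmetrized law of τ into a Gaussian, and given |τ|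
the variable y takes the values e^{±|τ|} with mean 1 (`lintegral_edgeDensity_mul`). For fixed z, a
larger r gives a smaller |τ|, hence a less spread two-point law and a smaller integral of a convex
function (`twoPoint_le_of_convexOn`).

Another edge is moved to {0, δ} by transpositions of the vertices. Changing the root multiplies the
density by an exponential, so F is replaced by its perspective s F(x/s), which is again convex
(`convexOn_perspective`).

All this is done with Lebesgue integrals of functions that are nonnegative on the orthant. Using the
concave version as well, the integrals of 1 and of the coordinates e^{t_k} do not depend on the
weights. A general F is a nonnegative convex function plus its tangent at the origin, and the
tangent part is integrable with constant integral. -/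

noncomputable section

set_option linter.unusedSectionVars false

namespace H22

/-! ### The weighted matrix-tree theorem -/

section MatrixTree

variable {ι : Type*} [Fintype ι] [DecidableEq ι]

/-- The Laplacian of the weighted complete graph on `Option ι`, with the row and column of the
root `none` removed. -/
def redLaplacian (C : Sym2 (Option ι) → ℝ) : Matrix ι ι ℝ :=
  Matrix.of fun k l => (if k = l then ∑ b, C s(some k, b) else 0) - C s(some k, some l)

/-- `f` assigns to every vertex other than the root a parent, without creating cycles. -/
def IsParentMap (f : ι → Option ι) : Prop :=
  ∃ d : Option ι → ℕ, ∀ k, d (f k) < d (some k)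

/-- The graph in which every vertex is joined to its parent. -/
def parentGraph (f : ι → Option ι) : SimpleGraph (Option ι) :=
  SimpleGraph.fromEdgeSet (Set.range fun k => s(some k, f k))

/-- The row of the Laplacian that corresponds to the edge from `k` to `b`. -/
def edgeRow (k : ι) (b : Option ι) : ι → ℝ :=
  fun l => (if k = l then 1 else 0) - (if b = some l then 1 else 0)

theorem redLaplacian_row (C : Sym2 (Option ι) → ℝ) (k : ι) :
    redLaplacian C k = ∑ b, C s(some k, b) • edgeRow k b := by
  ext l
  simp only [redLaplacian, Matrix.of_apply, Finset.sum_apply, Pi.smul_apply, edgeRow, smul_eq_mul,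
    mul_sub, Finset.sum_sub_distrib, mul_ite, mul_one, mul_zero, Finset.sum_ite_eq',
    Finset.mem_univ, if_true]
  split_ifs <;> simp

/-- Each row is a sum over the edges leaving its vertex, so multilinearity gives a sum over choices
of one outgoing edge per vertex. -/
theorem det_redLaplacian_eq_sum (C : Sym2 (Option ι) → ℝ) :
    (redLaplacian C).det = ∑ f : ι → Option ι,
      (∏ k, C s(some k, f k)) * Matrix.det (Matrix.of fun k => edgeRow k (f k)) := by
  have h := (Matrix.detRowAlternating (R := ℝ) (n := ι)).toMultilinearMap.map_sum
    (fun k (b : Option ι) => C s(some k, b) • edgeRow k b)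
  have h2 : (redLaplacian C).det = Matrix.detRowAlternating.toMultilinearMap
      (fun k => ∑ b, C s(some k, b) • edgeRow k b) := by
    simp only [← redLaplacian_row]
    rfl
  rw [h2, h]
  refine Finset.sum_congr rfl fun f _ => ?_
  rw [MultilinearMap.map_smul_univ]
  rfl

/-- Ordered by the height d, the matrix is triangular with unit diagonal. -/
theorem det_edgeRow_of_isParentMap {f : ι → Option ι} (hf : IsParentMap f) :
    Matrix.det (Matrix.of fun k => edgeRow k (f k)) = 1 := by
  obtain ⟨d, hd⟩ := hf
  have key : ∀ k l, d (some k) ≤ d (some l) → edgeRow k (f k) l = if k = l then 1 else 0 := by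
    intro k l hkl
    have : f k ≠ some l := fun h => by have := hd k; rw [h] at this; omega
    simp [edgeRow, this]
  have hb : Matrix.BlockTriangular (Matrix.of fun k => edgeRow k (f k))
      (fun k => OrderDual.toDual (d (some k))) := by
    intro k l hkl
    have hkl' : d (some k) < d (some l) := hkl
    have hne : k ≠ l := by rintro rfl; exact lt_irrefl _ hkl'
    simp [key k l hkl'.le, hne]
  rw [hb.det]
  refine Finset.prod_eq_one fun a _ => ?_
  rw [show Matrix.toSquareBlock (Matrix.of fun k => edgeRow k (f k))
      (fun k => OrderDual.toDual (d (some k))) a = 1 from ?_, Matrix.det_one]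
  ext ⟨k, hk⟩ ⟨l, hl⟩
  have : d (some k) ≤ d (some l) :=
    le_of_eq (OrderDual.toDual.injective (hk.trans hl.symm))
  simp [Matrix.toSquareBlock_def, key k l this, Matrix.one_apply]

/-- The indicator of the vertices that never reach the root under iteration of f is a nonzero kernel
vector. If every vertex reached the root, the hitting time would be a height. -/
theorem det_edgeRow_of_not_isParentMap {f : ι → Option ι} (hf : ¬ IsParentMap f) :
    Matrix.det (Matrix.of fun k => edgeRow k (f k)) = 0 := by
  classical
  let g : Option ι → Option ι := fun v => v.elim none f
  by_cases hall : ∀ k : Option ι, ∃ m, g^[m] k = none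
  · refine absurd ⟨fun v => Nat.find (hall v), fun k => ?_⟩ hf
    have h1 := Nat.find_spec (hall (some k))
    obtain ⟨m, hm⟩ : ∃ m, Nat.find (hall (some k)) = m + 1 := by
      refine Nat.exists_eq_succ_of_ne_zero fun h => ?_
      rw [h] at h1
      simp at h1
    change Nat.find (hall (f k)) < Nat.find (hall (some k))
    rw [hm] at h1 ⊢
    exact Nat.lt_succ_of_le (Nat.find_min' _ h1)
  · push Not at hall
    obtain ⟨v, hv⟩ := hall
    have hsome : ∃ k, v = some k := by
      cases v with
      | none => exact absurd rfl (hv 0)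
      | some k => exact ⟨k, rfl⟩
    obtain ⟨k₀, rfl⟩ := hsome
    let u : Option ι → ℝ := fun v => if ∃ m, g^[m] v = none then 0 else 1
    have hu0 : u none = 0 := if_pos ⟨0, rfl⟩
    have hu : ∀ k, u (f k) = u (some k) := by
      intro k
      have : (∃ m, g^[m] (f k) = none) ↔ ∃ m, g^[m] (some k) = none := by
        constructor
        · rintro ⟨m, hm⟩
          exact ⟨m + 1, hm⟩
        · rintro ⟨m, hm⟩
          cases m with
          | zero => simp at hm
          | succ m => exact ⟨m, hm⟩
      simp only [u, this]
    refine Matrix.exists_mulVec_eq_zero_iff.1 ⟨fun k => u (some k), fun h => ?_, ?_⟩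
    · have := congrFun h k₀
      have hne : ¬ ∃ m, g^[m] (some k₀) = none := by push Not; exact hv
      simp [u, hne] at this
    · ext k
      simp only [Matrix.mulVec, dotProduct, Matrix.of_apply, edgeRow, sub_mul, ite_mul, one_mul,
        zero_mul, Finset.sum_sub_distrib, Finset.sum_ite_eq, Finset.mem_univ, if_true,
        Pi.zero_apply]
      rw [← hu k]
      cases hfk : f k with
      | none => simp [hu0]
      | some j => simp

theorem IsParentMap.edge_injective {f : ι → Option ι} (hf : IsParentMap f) :
    Function.Injective fun k => s(some k, f k) := by
  obtain ⟨d, hd⟩ := hf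
  intro k l hkl
  rcases Sym2.eq_iff.1 hkl with ⟨h, -⟩ | ⟨h1, h2⟩
  · exact Option.some_injective _ h
  · have := hd k
    have := hd l
    rw [h2] at *
    rw [← h1] at *
    omega

theorem IsParentMap.edgeSet_eq {f : ι → Option ι} (hf : IsParentMap f) :
    (parentGraph f).edgeSet = Set.range fun k => s(some k, f k) := by
  obtain ⟨d, hd⟩ := hf
  rw [parentGraph, SimpleGraph.edgeSet_fromEdgeSet, sdiff_eq_left, Set.disjoint_left]
  rintro _ ⟨k, rfl⟩ hk
  have h : some k = f k := by simpa using hk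
  have := hd k
  rw [← h] at this
  exact lt_irrefl _ this

theorem IsParentMap.adj {f : ι → Option ι} (hf : IsParentMap f) (k : ι) :
    (parentGraph f).Adj (some k) (f k) := by
  rw [← SimpleGraph.mem_edgeSet, hf.edgeSet_eq]
  exact ⟨k, rfl⟩

theorem IsParentMap.connected {f : ι → Option ι} (hf : IsParentMap f) :
    (parentGraph f).Connected := by
  obtain ⟨d, hd⟩ := id hf
  have h : ∀ n v, d v = n → (parentGraph f).Reachable v none := by
    intro n
    induction n using Nat.strong_induction_on with
    | _ n ih =>
      intro v hv
      cases v with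
      | none => exact SimpleGraph.Reachable.refl _
      | some k => exact (hf.adj k).reachable.trans (ih _ (hv ▸ hd k) _ rfl)
  exact ⟨fun u v => (h _ u rfl).trans (h _ v rfl).symm⟩

theorem IsParentMap.isTree {f : ι → Option ι} (hf : IsParentMap f) :
    (parentGraph f).IsTree := by
  rw [SimpleGraph.isTree_iff_connected_and_card]
  refine ⟨hf.connected, ?_⟩
  rw [hf.edgeSet_eq, Nat.card_range_of_injective hf.edge_injective]
  simp

theorem IsParentMap.eq_of_parentGraph_eq {f g : ι → Option ι} (hf : IsParentMap f)
    (hg : IsParentMap g) (h : parentGraph f = parentGraph g) : f = g := by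
  obtain ⟨d, hd⟩ := id hf
  have key : ∀ n k, d (some k) = n → f k = g k := by
    intro n
    induction n using Nat.strong_induction_on with
    | _ n ih =>
      intro k hk
      have hmem : s(some k, f k) ∈ (parentGraph g).edgeSet := by
        rw [← h, hf.edgeSet_eq]
        exact ⟨k, rfl⟩
      rw [hg.edgeSet_eq] at hmem
      obtain ⟨l, hl⟩ := hmem
      rcases Sym2.eq_iff.1 hl with ⟨h1, h2⟩ | ⟨h1, h2⟩
      · rw [← h2, Option.some_injective _ h1]
      -- Here the edge is the one that g attaches to l = f k, so g l = k. By induction f l = k as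
      -- well, and f would contain a 2-cycle.
      · have h3 := hd k
        rw [← h1] at h3
        have h4 := ih _ (hk ▸ h3) l rfl
        have h5 := hd l
        rw [h4, h2] at h5
        omega
  exact funext fun k => key _ k rfl

/-- The parent is the next vertex on a shortest walk to the root. The resulting graph is connected
and lies in T, and a tree is a minimal connected graph. -/
theorem exists_isParentMap_of_isTree {T : SimpleGraph (Option ι)} (hT : T.IsTree) :
    ∃ f, IsParentMap f ∧ parentGraph f = T := by
  have hstep : ∀ k : ι, ∃ b, T.Adj (some k) b ∧ T.dist b none < T.dist (some k) none := by
    intro k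
    obtain ⟨p, hp⟩ := (hT.connected (some k) none).exists_walk_length_eq_dist
    cases p with
    | cons h q =>
      refine ⟨_, h, ?_⟩
      rw [← hp, SimpleGraph.Walk.length_cons]
      exact Nat.lt_succ_of_le (SimpleGraph.dist_le q)
  choose f hadj hdist using hstep
  have hf : IsParentMap f := ⟨fun v => T.dist v none, hdist⟩
  refine ⟨f, hf, ?_⟩
  have hle : parentGraph f ≤ T := by
    rw [← SimpleGraph.edgeSet_subset_edgeSet, hf.edgeSet_eq]
    rintro _ ⟨k, rfl⟩
    exact hadj k
  exact le_antisymm hle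
    ((SimpleGraph.isTree_iff_minimal_connected.1 hT).le_of_le hf.connected hle)

open Classical in
/-- The weighted matrix-tree theorem. -/
theorem det_redLaplacian (C : Sym2 (Option ι) → ℝ) :
    (redLaplacian C).det = ∑ T : SimpleGraph (Option ι) with T.IsTree,
      ∏ e : Sym2 (Option ι) with e ∈ T.edgeSet, C e := by
  rw [det_redLaplacian_eq_sum, ← Finset.sum_filter_add_sum_filter_not Finset.univ IsParentMap]
  rw [Finset.sum_eq_zero (s := Finset.univ.filter fun f => ¬ IsParentMap f), add_zero]
  · refine Finset.sum_bij (fun f _ => parentGraph f) ?_ ?_ ?_ ?_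
    · intro f hf
      simpa using (Finset.mem_filter.1 hf).2.isTree
    · intro f hf g hg h
      exact (Finset.mem_filter.1 hf).2.eq_of_parentGraph_eq (Finset.mem_filter.1 hg).2 h
    · intro T hT
      obtain ⟨f, hf, rfl⟩ := exists_isParentMap_of_isTree (Finset.mem_filter.1 hT).2
      exact ⟨f, by simpa using hf, rfl⟩
    · intro f hf
      have hf := (Finset.mem_filter.1 hf).2
      rw [det_edgeRow_of_isParentMap hf, mul_one]
      have : (Finset.univ.filter fun e => e ∈ (parentGraph f).edgeSet) =
          Finset.univ.image fun k => s(some k, f k) := by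
        ext e
        simp only [Finset.mem_filter, Finset.mem_univ, true_and, hf.edgeSet_eq, Set.mem_range,
          Finset.mem_image]
      rw [this, Finset.prod_image fun _ _ _ _ h => hf.edge_injective h]
  · intro f hf
    rw [det_edgeRow_of_not_isParentMap (Finset.mem_filter.1 hf).2, mul_zero]

end MatrixTree

/-! ### The one-dimensional effective field -/

/-- The mean of `f` under the law on `{e^τ, e^{-τ}}` with expectation one. -/
def twoPoint (f : ℝ → ℝ) (τ : ℝ) : ℝ :=
  f (Real.exp τ) / (1 + Real.exp τ) + f (Real.exp (-τ)) / (1 + Real.exp (-τ))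

/-- The density of the effective field on a single edge of weight `r`. -/
def edgeDensity (r τ : ℝ) : ℝ :=
  Real.sqrt (r / (2 * Real.pi)) * Real.exp (-τ / 2) * Real.exp (-(r * (Real.cosh τ - 1)))

theorem edgeDensity_nonneg (r τ : ℝ) : 0 ≤ edgeDensity r τ := by
  unfold edgeDensity
  positivity

theorem twoPoint_neg (f : ℝ → ℝ) (τ : ℝ) : twoPoint f (-τ) = twoPoint f τ := by
  simp only [twoPoint, neg_neg]
  ring

theorem twoPoint_abs (f : ℝ → ℝ) (τ : ℝ) : twoPoint f |τ| = twoPoint f τ := by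
  rcases abs_choice τ with h | h <;> rw [h]
  exact twoPoint_neg f τ

/-- The law on e^{±t} is a mean-preserving spread of the law on e^{±s}: split each inner point
between the outer ones. -/
theorem twoPoint_le_of_convexOn {f : ℝ → ℝ} (hf : ConvexOn ℝ (Set.Ioi 0) f) {s t : ℝ}
    (hs : 0 ≤ s) (hst : s ≤ t) : twoPoint f s ≤ twoPoint f t := by
  rcases hs.eq_or_lt with rfl | hs
  -- The inner law is the point mass at 1 and this is Jensen. It is separate because t may vanish
  -- too, and then the chord used below degenerates.
  · have h := hf.2 (Real.exp_pos t) (Real.exp_pos (-t))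
      (show 0 ≤ 1 / (1 + Real.exp t) by positivity)
      (show 0 ≤ 1 / (1 + Real.exp (-t)) by positivity)
      (by rw [Real.exp_neg]; have := Real.exp_pos t; field_simp; ring)
    have h1 : (1 / (1 + Real.exp t)) • Real.exp t + (1 / (1 + Real.exp (-t))) • Real.exp (-t) = 1 := by
      simp only [smul_eq_mul]
      rw [Real.exp_neg]
      have := Real.exp_pos t
      field_simp
      ring
    rw [h1] at h
    simp only [smul_eq_mul] at h
    simp only [twoPoint, neg_zero, Real.exp_zero]
    calc _ = f 1 := by ring
      _ ≤ _ := h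
      _ = _ := by ring
  · set X := Real.exp t with hX
    set Y := Real.exp s with hY
    have hY1 : 1 < Y := Real.one_lt_exp_iff.2 hs
    have hYX : Y ≤ X := Real.exp_le_exp.2 hst
    have hX1 : 1 < X := hY1.trans_le hYX
    have hX0 : 0 < X := by linarith
    have hY0 : 0 < Y := by linarith
    have hD : 0 < X ^ 2 - 1 := by nlinarith
    have hD0 : X ^ 2 - 1 ≠ 0 := hD.ne'
    have e1 : Real.exp (-t) = X⁻¹ := Real.exp_neg t
    have e2 : Real.exp (-s) = Y⁻¹ := Real.exp_neg s
    have hXY : 1 ≤ X * Y := by nlinarith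
    -- The coefficients in `h1` and `h2` are the barycentric coordinates of Y and of Y⁻¹ in the
    -- interval from X⁻¹ to X.
    have h1 := hf.2 hX0 (inv_pos.2 hX0)
      (show 0 ≤ (X * Y - 1) / (X ^ 2 - 1) from div_nonneg (by linarith) hD.le)
      (show 0 ≤ X * (X - Y) / (X ^ 2 - 1) from
        div_nonneg (mul_nonneg hX0.le (by linarith)) hD.le) (by field_simp; ring)
    have h2 := hf.2 hX0 (inv_pos.2 hX0)
      (show 0 ≤ (X - Y) / (Y * (X ^ 2 - 1)) from div_nonneg (by linarith) (by positivity))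
      (show 0 ≤ X * (X * Y - 1) / (Y * (X ^ 2 - 1)) from
        div_nonneg (mul_nonneg hX0.le (by linarith)) (by positivity)) (by field_simp; ring)
    have p1 : ((X * Y - 1) / (X ^ 2 - 1)) • X + (X * (X - Y) / (X ^ 2 - 1)) • X⁻¹ = Y := by
      simp only [smul_eq_mul]
      field_simp
      ring
    have p2 : ((X - Y) / (Y * (X ^ 2 - 1))) • X + (X * (X * Y - 1) / (Y * (X ^ 2 - 1))) • X⁻¹
        = Y⁻¹ := by
      simp only [smul_eq_mul]
      field_simp
      ring
    rw [p1] at h1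
    rw [p2] at h2
    simp only [smul_eq_mul] at h1 h2
    simp only [twoPoint, e1, e2, ← hX, ← hY]
    calc f Y / (1 + Y) + f Y⁻¹ / (1 + Y⁻¹)
        ≤ ((X * Y - 1) / (X ^ 2 - 1) * f X + X * (X - Y) / (X ^ 2 - 1) * f X⁻¹) / (1 + Y)
          + ((X - Y) / (Y * (X ^ 2 - 1)) * f X
            + X * (X * Y - 1) / (Y * (X ^ 2 - 1)) * f X⁻¹) / (1 + Y⁻¹) := by
          have : 0 < 1 + Y⁻¹ := by positivity
          gcongr
      _ = f X / (1 + X) + f X⁻¹ / (1 + X⁻¹) := by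
          have q1 : (X * Y - 1) / (X ^ 2 - 1) / (1 + Y)
              + (X - Y) / (Y * (X ^ 2 - 1)) / (1 + Y⁻¹) = 1 / (1 + X) := by
            field_simp
            ring
          have q2 : X * (X - Y) / (X ^ 2 - 1) / (1 + Y)
              + X * (X * Y - 1) / (Y * (X ^ 2 - 1)) / (1 + Y⁻¹) = 1 / (1 + X⁻¹) := by
            field_simp
            ring
          linear_combination f X * q1 + f X⁻¹ * q2

theorem lintegral_edgeDensity_mul {r : ℝ} (hr : 0 < r) {f : ℝ → ℝ} (hfm : Measurable f)
    (hf : ∀ y, 0 < y → 0 ≤ f y) :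
    ∫⁻ τ, ENNReal.ofReal (edgeDensity r τ * f (Real.exp τ)) =
      ∫⁻ z, ENNReal.ofReal (Real.exp (-z ^ 2 / 2) / Real.sqrt (2 * Real.pi)
        * twoPoint f (2 * Real.arsinh (z / (2 * Real.sqrt r)))) := by
  have hsr : 0 < Real.sqrt r := Real.sqrt_pos.2 hr
  have hm : Measurable fun τ => ENNReal.ofReal (edgeDensity r τ * f (Real.exp τ)) := by
    unfold edgeDensity
    fun_prop
  have hd : ∀ τ ∈ (Set.univ : Set ℝ), HasDerivWithinAt (fun τ => 2 * Real.sqrt r * Real.sinh (τ / 2))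
      (Real.sqrt r * Real.cosh (τ / 2)) Set.univ τ := by
    intro τ _
    have h1 : HasDerivAt (fun τ : ℝ => τ / 2) (1 / 2) τ := (hasDerivAt_id τ).div_const 2
    have h2 := (h1.sinh).const_mul (2 * Real.sqrt r)
    refine (h2.congr_deriv ?_).hasDerivWithinAt
    ring
  have hinj : Set.InjOn (fun τ => 2 * Real.sqrt r * Real.sinh (τ / 2)) Set.univ := by
    intro a _ b _ hab
    have h3 : Real.sinh (a / 2) = Real.sinh (b / 2) := mul_left_cancel₀ (by positivity) hab
    have h4 := Real.sinh_injective h3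
    linarith
  have hsurj : (fun τ => 2 * Real.sqrt r * Real.sinh (τ / 2)) '' Set.univ = Set.univ := by
    refine Set.eq_univ_of_forall fun z => ⟨2 * Real.arsinh (z / (2 * Real.sqrt r)), trivial, ?_⟩
    simp only [mul_div_cancel_left₀ _ (two_ne_zero' ℝ), Real.sinh_arsinh]
    field_simp
  have hcv := lintegral_image_eq_lintegral_abs_deriv_mul MeasurableSet.univ hd hinj
    (fun z => ENNReal.ofReal (Real.exp (-z ^ 2 / 2) / Real.sqrt (2 * Real.pi)
        * twoPoint f (2 * Real.arsinh (z / (2 * Real.sqrt r)))))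
  rw [hsurj, Measure.restrict_univ] at hcv
  -- Both sides are doubled so that one copy on the left can be reflected by τ ↦ -τ. The symmetrized
  -- integrands agree pointwise because 2 cosh(τ/2) = e^{-τ/2}(1 + e^τ).
  rw [hcv, ← ENNReal.mul_right_inj (two_ne_zero) (ENNReal.ofNat_ne_top (n := 2))]
  have hneg : ∫⁻ τ, ENNReal.ofReal (edgeDensity r τ * f (Real.exp τ)) =
      ∫⁻ τ, ENNReal.ofReal (edgeDensity r (-τ) * f (Real.exp (-τ))) :=
    (lintegral_neg_eq_self (μ := volume)
      (fun τ => ENNReal.ofReal (edgeDensity r τ * f (Real.exp τ)))).symm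
  rw [← lintegral_const_mul' 2 _ ENNReal.ofNat_ne_top,
    lintegral_const_mul' 2 _ ENNReal.ofNat_ne_top, two_mul]
  nth_rewrite 1 [hneg]
  rw [← lintegral_add_right _ hm, ← lintegral_const_mul' 2 _ ENNReal.ofNat_ne_top]
  refine lintegral_congr fun τ => ?_
  have hp := hf _ (Real.exp_pos τ)
  have hq := hf _ (Real.exp_pos (-τ))
  rw [← ENNReal.ofReal_add (mul_nonneg (edgeDensity_nonneg _ _) hq)
    (mul_nonneg (edgeDensity_nonneg _ _) hp), ← ENNReal.ofReal_mul (abs_nonneg _),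
    abs_of_nonneg (by positivity), ← ENNReal.ofReal_ofNat 2, ← ENNReal.ofReal_mul (by norm_num)]
  congr 1
  have harg : 2 * Real.sqrt r * Real.sinh (τ / 2) / (2 * Real.sqrt r) = Real.sinh (τ / 2) := by
    field_simp
  rw [harg, Real.arsinh_sinh, mul_div_cancel₀ _ (two_ne_zero' ℝ)]
  have hexp : -(2 * Real.sqrt r * Real.sinh (τ / 2)) ^ 2 / 2 = -(r * (Real.cosh τ - 1)) := by
    have h1 : Real.cosh τ = 1 + 2 * Real.sinh (τ / 2) ^ 2 := by
      have := Real.cosh_two_mul (τ / 2)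
      rw [mul_div_cancel₀ _ (two_ne_zero' ℝ)] at this
      rw [this, Real.cosh_sq]
      ring
    rw [h1, mul_pow, mul_pow, Real.sq_sqrt hr.le]
    ring
  rw [hexp]
  simp only [edgeDensity, twoPoint, Real.cosh_neg, Real.sqrt_div' r (by positivity : 0 ≤ 2 * Real.pi)]
  have hc : Real.cosh (τ / 2) = (Real.exp (τ / 2) + (Real.exp (τ / 2))⁻¹) / 2 := by
    rw [Real.cosh_eq, Real.exp_neg]
  have e1 : Real.exp τ = Real.exp (τ / 2) ^ 2 := by
    rw [← Real.exp_nat_mul]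
    congr 1
    push_cast
    ring
  have e2 : Real.exp (-τ) = (Real.exp (τ / 2) ^ 2)⁻¹ := by rw [Real.exp_neg, e1]
  have e3 : Real.exp (-τ / 2) = (Real.exp (τ / 2))⁻¹ := by rw [neg_div, Real.exp_neg]
  have e4 : Real.exp (- -τ / 2) = Real.exp (τ / 2) := by rw [neg_neg]
  rw [e3, e4, hc, e2, e1]
  have := Real.exp_pos (τ / 2)
  have : 0 < Real.sqrt (2 * Real.pi) := by positivity
  field_simp
  ring

/-- The one-dimensional field decreases in the convex order as the weight increases. -/
theorem twoPoint_arsinh_antitone {f : ℝ → ℝ} (hf : ConvexOn ℝ (Set.Ioi 0) f) (z : ℝ) {r s : ℝ}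
    (hr : 0 < r) (hrs : r ≤ s) :
    twoPoint f (2 * Real.arsinh (z / (2 * Real.sqrt s))) ≤
      twoPoint f (2 * Real.arsinh (z / (2 * Real.sqrt r))) := by
  rw [← twoPoint_abs f (2 * Real.arsinh (z / (2 * Real.sqrt s))),
    ← twoPoint_abs f (2 * Real.arsinh (z / (2 * Real.sqrt r)))]
  refine twoPoint_le_of_convexOn hf (abs_nonneg _) ?_
  have key : ∀ q : ℝ, |2 * Real.arsinh (z / (2 * Real.sqrt q))| =
      2 * Real.arsinh (|z| / (2 * Real.sqrt q)) := by
    intro q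
    rcases le_total 0 z with hz | hz
    · rw [abs_of_nonneg hz, abs_of_nonneg]
      have := Real.arsinh_nonneg_iff.2 (show 0 ≤ z / (2 * Real.sqrt q) by positivity)
      positivity
    · rw [abs_of_nonpos hz, neg_div, Real.arsinh_neg, abs_of_nonpos]
      · ring
      · have := Real.arsinh_nonpos_iff.2 (div_nonpos_of_nonpos_of_nonneg hz
          (show 0 ≤ 2 * Real.sqrt q by positivity))
        linarith
  rw [key, key]
  have h1 : 0 < Real.sqrt r := Real.sqrt_pos.2 hr
  gcongr

theorem lintegral_edgeDensity_antitone {f : ℝ → ℝ} (hfm : Measurable f)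
    (hf0 : ∀ y, 0 < y → 0 ≤ f y) (hf : ConvexOn ℝ (Set.Ioi 0) f) {r s : ℝ} (hr : 0 < r)
    (hrs : r ≤ s) :
    ∫⁻ τ, ENNReal.ofReal (edgeDensity s τ * f (Real.exp τ)) ≤
      ∫⁻ τ, ENNReal.ofReal (edgeDensity r τ * f (Real.exp τ)) := by
  rw [lintegral_edgeDensity_mul hr hfm hf0, lintegral_edgeDensity_mul (hr.trans_le hrs) hfm hf0]
  refine lintegral_mono fun z => ENNReal.ofReal_le_ofReal ?_
  exact mul_le_mul_of_nonneg_left (twoPoint_arsinh_antitone hf z hr hrs) (by positivity)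

theorem lintegral_edgeDensity_monotone {f : ℝ → ℝ} (hfm : Measurable f)
    (hf0 : ∀ y, 0 < y → 0 ≤ f y) (hf : ConcaveOn ℝ (Set.Ioi 0) f) {r s : ℝ} (hr : 0 < r)
    (hrs : r ≤ s) :
    ∫⁻ τ, ENNReal.ofReal (edgeDensity r τ * f (Real.exp τ)) ≤
      ∫⁻ τ, ENNReal.ofReal (edgeDensity s τ * f (Real.exp τ)) := by
  rw [lintegral_edgeDensity_mul hr hfm hf0, lintegral_edgeDensity_mul (hr.trans_le hrs) hfm hf0]
  refine lintegral_mono fun z => ENNReal.ofReal_le_ofReal ?_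
  have h := twoPoint_arsinh_antitone hf.neg z hr hrs
  have hn : ∀ τ, twoPoint (-f) τ = -twoPoint f τ := fun τ => by
    simp only [twoPoint, Pi.neg_apply]
    ring
  rw [hn, hn, neg_le_neg_iff] at h
  exact mul_le_mul_of_nonneg_left h (by positivity)

/-! ### The change of variables to the random potential -/

section Potential

variable {ι : Type*} [Fintype ι] [DecidableEq ι]

/-- The Schrödinger operator with potential `β` and off-diagonal part `-A`. -/
def schrodinger (A : Matrix ι ι ℝ) (β : ι → ℝ) : Matrix ι ι ℝ :=
  Matrix.diagonal β - A

/-- The potentials whose Schrödinger operator is positive. -/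
def posPotential (A : Matrix ι ι ℝ) : Set (ι → ℝ) :=
  {β | ∃ s : ι → ℝ, (∀ k, 0 < s k) ∧ ∀ k, 0 < (schrodinger A β).mulVec s k}

/-- The potential determined by the field `t`: the one for which `e^t` solves `H e^t = r`. -/
def potential (A : Matrix ι ι ℝ) (r t : ι → ℝ) : ι → ℝ :=
  fun k => ∑ l, A k l * Real.exp (t l - t k) + r k * Real.exp (-t k)

/-- The solution of `H v = r`. -/
def green (A : Matrix ι ι ℝ) (β r : ι → ℝ) : ι → ℝ :=
  (schrodinger A β)⁻¹.mulVec r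

theorem schrodinger_mulVec (A : Matrix ι ι ℝ) (β v : ι → ℝ) (k : ι) :
    (schrodinger A β).mulVec v k = β k * v k - ∑ l, A k l * v l := by
  rw [schrodinger, Matrix.sub_mulVec, Pi.sub_apply, Matrix.mulVec_diagonal]
  rfl

theorem schrodinger_potential_mulVec (A : Matrix ι ι ℝ) (r t : ι → ℝ) :
    (schrodinger A (potential A r t)).mulVec (fun k => Real.exp (t k)) = r := by
  ext k
  rw [schrodinger_mulVec, potential, add_mul, Finset.sum_mul, mul_assoc, ← Real.exp_add,
    neg_add_cancel, Real.exp_zero, mul_one]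
  simp only [mul_assoc, ← Real.exp_add, sub_add_cancel]
  ring

variable {A : Matrix ι ι ℝ}

/-- Minimum principle: compare v with the positive strict supersolution s at a vertex where v / s is
smallest. -/
theorem nonneg_of_schrodinger_mulVec_nonneg (hA : ∀ k l, k ≠ l → 0 ≤ A k l) {β : ι → ℝ}
    (hβ : β ∈ posPotential A) {v : ι → ℝ} (hv : ∀ k, 0 ≤ (schrodinger A β).mulVec v k) (k : ι) :
    0 ≤ v k := by
  obtain ⟨s, hs, hHs⟩ := hβ
  have : Nonempty ι := ⟨k⟩
  obtain ⟨j, hj⟩ := Finite.exists_min fun l => v l / s l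
  by_contra! hk
  set m := v j / s j with hm
  have hm0 : m < 0 := (hj k).trans_lt (div_neg_of_neg_of_pos hk (hs k))
  have hle : ∀ l, m * s l ≤ v l := fun l => (le_div_iff₀ (hs l)).1 (hj l)
  have heq : v j = m * s j := by rw [hm, div_mul_cancel₀ _ (hs j).ne']
  have h1 := hv j
  have h2 := mul_neg_of_neg_of_pos hm0 (hHs j)
  rw [schrodinger_mulVec] at h1 h2
  have h3 : ∑ l, A j l * (m * s l) ≤ ∑ l, A j l * v l := by
    refine Finset.sum_le_sum fun l _ => ?_
    -- The diagonal of A has no sign, but at l = j the comparison is an equality.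
    rcases eq_or_ne j l with rfl | hjl
    · rw [heq]
    · exact mul_le_mul_of_nonneg_left (hle l) (hA j l hjl)
  have h4 : m * (β j * s j - ∑ l, A j l * s l) = β j * v j - ∑ l, A j l * (m * s l) := by
    rw [heq, mul_sub, Finset.mul_sum]
    congr 1
    · ring
    · exact Finset.sum_congr rfl fun l _ => by ring
  linarith

theorem det_schrodinger_ne_zero (hA : ∀ k l, k ≠ l → 0 ≤ A k l) {β : ι → ℝ}
    (hβ : β ∈ posPotential A) : (schrodinger A β).det ≠ 0 := by
  intro h
  obtain ⟨v, hv, hv0⟩ := Matrix.exists_mulVec_eq_zero_iff.2 h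
  refine hv (funext fun k => le_antisymm ?_ ?_)
  · have := nonneg_of_schrodinger_mulVec_nonneg hA hβ (v := -v)
      (fun k => by simp [Matrix.mulVec_neg, hv0]) k
    simpa using this
  · exact nonneg_of_schrodinger_mulVec_nonneg hA hβ (fun k => by simp [hv0]) k

theorem schrodinger_mulVec_green (hA : ∀ k l, k ≠ l → 0 ≤ A k l) {β : ι → ℝ}
    (hβ : β ∈ posPotential A) (r : ι → ℝ) : (schrodinger A β).mulVec (green A β r) = r := by
  rw [green, Matrix.mulVec_mulVec,
    Matrix.mul_nonsing_inv _ (isUnit_iff_ne_zero.2 (det_schrodinger_ne_zero hA hβ)),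
    Matrix.one_mulVec]

theorem green_eq_of_mulVec_eq (hA : ∀ k l, k ≠ l → 0 ≤ A k l) {β : ι → ℝ}
    (hβ : β ∈ posPotential A) {v r : ι → ℝ} (h : (schrodinger A β).mulVec v = r) :
    green A β r = v := by
  rw [green, ← h, Matrix.mulVec_mulVec,
    Matrix.nonsing_inv_mul _ (isUnit_iff_ne_zero.2 (det_schrodinger_ne_zero hA hβ)),
    Matrix.one_mulVec]

theorem green_nonneg (hA : ∀ k l, k ≠ l → 0 ≤ A k l) {β : ι → ℝ}
    (hβ : β ∈ posPotential A) {r : ι → ℝ} (hr : ∀ k, 0 ≤ r k) (k : ι) : 0 ≤ green A β r k :=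
  nonneg_of_schrodinger_mulVec_nonneg hA hβ
    (fun l => by rw [schrodinger_mulVec_green hA hβ]; exact hr l) k

theorem green_pos (hA : ∀ k l, k ≠ l → 0 ≤ A k l) {β : ι → ℝ}
    (hβ : β ∈ posPotential A) {r : ι → ℝ} (hr : ∀ k, 0 < r k) (k : ι) : 0 < green A β r k := by
  have h0 := green_nonneg hA hβ fun l => (hr l).le
  refine (h0 k).lt_of_ne fun h => ?_
  have h1 := congrFun (schrodinger_mulVec_green hA hβ r) k
  rw [schrodinger_mulVec, ← h, mul_zero] at h1
  have h2 : 0 ≤ ∑ l, A k l * green A β r l := by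
    refine Finset.sum_nonneg fun l _ => ?_
    rcases eq_or_ne k l with rfl | hkl
    · rw [← h, mul_zero]
    · exact mul_nonneg (hA k l hkl) (h0 l)
  have := hr k
  linarith

theorem potential_mem (A : Matrix ι ι ℝ) {r : ι → ℝ} (hr : ∀ k, 0 < r k) (t : ι → ℝ) :
    potential A r t ∈ posPotential A :=
  ⟨fun k => Real.exp (t k), fun k => Real.exp_pos _, fun k => by
    rw [schrodinger_potential_mulVec]
    exact hr k⟩

theorem green_potential (hA : ∀ k l, k ≠ l → 0 ≤ A k l) {r : ι → ℝ} (hr : ∀ k, 0 < r k)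
    (t : ι → ℝ) : green A (potential A r t) r = fun k => Real.exp (t k) :=
  green_eq_of_mulVec_eq hA (potential_mem A hr t) (schrodinger_potential_mulVec A r t)

theorem potential_injective (hA : ∀ k l, k ≠ l → 0 ≤ A k l) {r : ι → ℝ} (hr : ∀ k, 0 < r k) :
    Function.Injective (potential A r) := by
  intro t t' h
  have h1 := green_potential hA hr t
  rw [h, green_potential hA hr t'] at h1
  exact funext fun k => (Real.exp_injective (congrFun h1 k)).symm

theorem range_potential (hA : ∀ k l, k ≠ l → 0 ≤ A k l) {r : ι → ℝ} (hr : ∀ k, 0 < r k) :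
    Set.range (potential A r) = posPotential A := by
  refine Set.Subset.antisymm (Set.range_subset_iff.2 (potential_mem A hr)) fun β hβ => ?_
  have hv := green_pos hA hβ hr
  refine ⟨fun k => Real.log (green A β r k), funext fun k => ?_⟩
  have h := congrFun (schrodinger_mulVec_green hA hβ r) k
  rw [schrodinger_mulVec] at h
  simp only [potential, Real.exp_sub, Real.exp_neg, Real.exp_log (hv _)]
  have hk := (hv k).ne'
  have h2 : ∑ l, A k l * (green A β r l / green A β r k) =
      (∑ l, A k l * green A β r l) / green A β r k := by
    rw [Finset.sum_div]
    exact Finset.sum_congr rfl fun l _ => by ring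
  rw [h2]
  field_simp
  linarith

theorem continuous_schrodinger (A : Matrix ι ι ℝ) : Continuous (schrodinger A) := by
  unfold schrodinger
  fun_prop

theorem measurable_det_schrodinger (A : Matrix ι ι ℝ) :
    Measurable fun β => (schrodinger A β).det :=
  (continuous_schrodinger A).matrix_det.measurable

theorem measurable_green (A : Matrix ι ι ℝ) (r : ι → ℝ) (k : ι) :
    Measurable fun β => green A β r k := by
  have h : ∀ β, green A β r k = (schrodinger A β).det⁻¹ *
      (schrodinger A β).adjugate.mulVec r k := by
    intro β
    rw [green, Matrix.inv_def, Ring.inverse_eq_inv', Matrix.smul_mulVec, Pi.smul_apply, smul_eq_mul]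
  simp only [h]
  refine (measurable_det_schrodinger A).inv.mul (Continuous.measurable ?_)
  exact (continuous_apply k).comp
    ((continuous_schrodinger A).matrix_adjugate.matrix_mulVec continuous_const)

/-- The solution of H s = 1 is a canonical supersolution, so the existential quantifier becomes
finitely many measurable conditions. -/
theorem measurableSet_posPotential (hA : ∀ k l, k ≠ l → 0 ≤ A k l) :
    MeasurableSet (posPotential A) := by
  have h : posPotential A = {β | (schrodinger A β).det ≠ 0} ∩
      ⋂ k, {β | 0 < green A β (fun _ => 1) k} := by
    ext β
    simp only [Set.mem_inter_iff, Set.mem_ofPred_eq, Set.mem_iInter]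
    constructor
    · exact fun hβ => ⟨det_schrodinger_ne_zero hA hβ, green_pos hA hβ fun _ => one_pos⟩
    · rintro ⟨hdet, hpos⟩
      refine ⟨_, hpos, fun k => ?_⟩
      rw [green, Matrix.mulVec_mulVec, Matrix.mul_nonsing_inv _ (isUnit_iff_ne_zero.2 hdet),
        Matrix.one_mulVec]
      exact one_pos
  rw [h]
  refine MeasurableSet.inter ?_ (MeasurableSet.iInter fun k => ?_)
  · exact (measurable_det_schrodinger A) (measurableSet_singleton 0).compl
  · exact measurableSet_lt measurable_const (measurable_green A _ k)

/-- The Jacobian matrix of `potential`. -/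
def potentialJacobian (A : Matrix ι ι ℝ) (r t : ι → ℝ) : Matrix ι ι ℝ :=
  Matrix.of fun k l => A k l * Real.exp (t l - t k) - if k = l then potential A r t k else 0

theorem hasFDerivAt_potential (A : Matrix ι ι ℝ) (r t : ι → ℝ) :
    HasFDerivAt (potential A r) (Matrix.toLin' (potentialJacobian A r t)).toContinuousLinearMap t := by
  rw [hasFDerivAt_pi']
  intro k
  have hp : ∀ l, HasFDerivAt (fun t : ι → ℝ => t l)
      (ContinuousLinearMap.proj (R := ℝ) (φ := fun _ : ι => ℝ) l) t := fun l => hasFDerivAt_apply l t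
  have h1 : HasFDerivAt (fun t : ι → ℝ => ∑ l, A k l * Real.exp (t l - t k)
      + r k * Real.exp (-t k)) _ t :=
    (HasFDerivAt.fun_sum fun l (_ : l ∈ Finset.univ) =>
      (((hp l).sub (hp k)).exp.const_mul (A k l))).add (((hp k).neg.exp).const_mul (r k))
  refine h1.congr_fderiv (ContinuousLinearMap.ext fun u => ?_)
  simp only [_root_.add_apply, _root_.sum_apply,
    _root_.smul_apply, _root_.sub_apply, _root_.neg_apply,
    ContinuousLinearMap.proj_apply, smul_eq_mul, ContinuousLinearMap.comp_apply,
    LinearMap.coe_toContinuousLinearMap', Matrix.toLin'_apply, Matrix.mulVec, dotProduct,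
    potentialJacobian, Matrix.of_apply, sub_mul, ite_mul, zero_mul, Finset.sum_sub_distrib,
    Finset.sum_ite_eq, Finset.mem_univ, if_true, mul_sub, potential, add_mul, Finset.sum_mul]
  simp only [mul_assoc, Pi.sub_apply, Pi.neg_apply]
  ring

/-- The Jacobian is -H conjugated by diag(e^t). -/
theorem abs_det_potentialJacobian (A : Matrix ι ι ℝ) (r t : ι → ℝ) :
    |(potentialJacobian A r t).det| = |(schrodinger A (potential A r t)).det| := by
  have h : potentialJacobian A r t = -(Matrix.diagonal (fun k => Real.exp (-t k)) *
      schrodinger A (potential A r t) * Matrix.diagonal fun k => Real.exp (t k)) := by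
    ext k l
    rw [Matrix.neg_apply, Matrix.mul_diagonal, Matrix.diagonal_mul, schrodinger, Matrix.sub_apply,
      Matrix.diagonal_apply, potentialJacobian, Matrix.of_apply]
    have h1 : Real.exp (t l - t k) = Real.exp (-t k) * Real.exp (t l) := by
      rw [← Real.exp_add]
      ring_nf
    rw [h1]
    split_ifs with hkl
    · subst hkl
      have h2 : Real.exp (-t k) * Real.exp (t k) = 1 := by
        rw [← Real.exp_add, neg_add_cancel, Real.exp_zero]
      linear_combination (potential A r t k) * h2
    · ring
  rw [h, Matrix.det_neg, Matrix.det_mul, Matrix.det_mul, Matrix.det_diagonal, Matrix.det_diagonal,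
    abs_mul, abs_pow, abs_neg, abs_one, one_pow, one_mul]
  congr 1
  have h3 : (∏ k, Real.exp (-t k)) * ∏ k, Real.exp (t k) = 1 := by
    rw [← Finset.prod_mul_distrib]
    refine Finset.prod_eq_one fun k _ => ?_
    rw [← Real.exp_add, neg_add_cancel, Real.exp_zero]
  linear_combination (schrodinger A (potential A r t)).det * h3

/-- The domain on the right does not depend on r. This is what later allows the integrals over τ and
β to be exchanged. -/
theorem lintegral_potential (hA : ∀ k l, k ≠ l → 0 ≤ A k l) {r : ι → ℝ} (hr : ∀ k, 0 < r k)
    (g : (ι → ℝ) → ℝ≥0∞) :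
    ∫⁻ t, ENNReal.ofReal |(schrodinger A (potential A r t)).det| * g (potential A r t) =
      ∫⁻ β in posPotential A, g β := by
  have h := lintegral_image_eq_lintegral_abs_det_fderiv_mul volume MeasurableSet.univ
    (fun t _ => (hasFDerivAt_potential A r t).hasFDerivWithinAt)
    (potential_injective hA hr).injOn g
  rw [Set.image_univ, range_potential hA hr, Measure.restrict_univ] at h
  rw [h]
  refine lintegral_congr fun t => ?_
  rw [← abs_det_potentialJacobian, ContinuousLinearMap.det, LinearMap.coe_toContinuousLinearMap,
    LinearMap.det_toLin']

end Potential

/-! ### Factorization of the density along one vertex -/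

theorem treeSum_eq_det {N : ℕ} (W : Weights N) (t : Fin N → ℝ) :
    treeSum W t = (redLaplacian (edgeFactor W t)).det := by
  rw [det_redLaplacian, treeSum]

section Block

variable {n : ℕ} (W : Weights (n + 1))

/-- The weights between the vertices other than the root and the vertex `0`. -/
def bulk : Matrix (Fin n) (Fin n) ℝ := Matrix.of fun k l => W s(some k.succ, some l.succ)

/-- The weights between the bulk and the vertex `0`. -/
def toZero (k : Fin n) : ℝ := W s(some k.succ, some 0)

/-- The weights between the bulk and the root. -/
def toRoot (k : Fin n) : ℝ := W s(some k.succ, none)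

/-- The bulk potential, given the field. -/
def bulkPotential (τ : ℝ) (t : Fin n → ℝ) : Fin n → ℝ :=
  potential (bulk W) (toRoot W + Real.exp τ • toZero W) t

/-- The conductance between the vertex `0` and the root through the bulk. -/
def bulkConductance (β : Fin n → ℝ) : ℝ := ∑ k, toZero W k * green (bulk W) β (toRoot W) k

theorem pin_cons_zero (τ : ℝ) (t : Fin n → ℝ) :
    pin (Fin.cons τ t : Fin (n + 1) → ℝ) (some 0) = τ := rfl

theorem pin_cons_succ (τ : ℝ) (t : Fin n → ℝ) (k : Fin n) :
    pin (Fin.cons τ t : Fin (n + 1) → ℝ) (some k.succ) = t k := rfl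

theorem pin_none {N : ℕ} (t : Fin N → ℝ) : pin t none = 0 := rfl

theorem bulk_transpose : (bulk W).transpose = bulk W := by
  ext k l
  simp only [bulk, Matrix.transpose_apply, Matrix.of_apply, Sym2.eq_swap]

variable {W}

theorem bulk_nonneg (hW : W.IsPositive) (k l : Fin n) (hkl : k ≠ l) : 0 ≤ bulk W k l :=
  (hW _ _ (by simpa using hkl)).le

theorem toZero_pos (hW : W.IsPositive) (k : Fin n) : 0 < toZero W k :=
  hW _ _ (by simp)

theorem toRoot_pos (hW : W.IsPositive) (k : Fin n) : 0 < toRoot W k :=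
  hW _ _ (by simp)

theorem source_pos (hW : W.IsPositive) (τ : ℝ) (k : Fin n) :
    0 < (toRoot W + Real.exp τ • toZero W) k := by
  have := toZero_pos hW k
  have := toRoot_pos hW k
  simp only [Pi.add_apply, Pi.smul_apply, smul_eq_mul]
  positivity

theorem bulkConductance_nonneg (hW : W.IsPositive) {β : Fin n → ℝ}
    (hβ : β ∈ posPotential (bulk W)) : 0 ≤ bulkConductance W β :=
  Finset.sum_nonneg fun k _ => mul_nonneg (toZero_pos hW k).le
    (green_nonneg (bulk_nonneg hW) hβ (fun l => (toRoot_pos hW l).le) k)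

theorem exp_eq_green (hW : W.IsPositive) (τ : ℝ) (t : Fin n → ℝ) (k : Fin n) :
    Real.exp (t k) = green (bulk W) (bulkPotential W τ t) (toRoot W) k
      + Real.exp τ * green (bulk W) (bulkPotential W τ t) (toZero W) k := by
  have h := congrFun (green_potential (bulk_nonneg hW) (source_pos hW τ) t) k
  rw [← h, bulkPotential, green, Matrix.mulVec_add, Matrix.mulVec_smul]
  rfl

/-- Symmetry of H: the conductance may be read from either end. -/
theorem toRoot_dot_green (hW : W.IsPositive) {β : Fin n → ℝ} (hβ : β ∈ posPotential (bulk W)) :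
    ∑ k, toRoot W k * green (bulk W) β (toZero W) k = bulkConductance W β := by
  have hT : (schrodinger (bulk W) β).transpose = schrodinger (bulk W) β := by
    rw [schrodinger, Matrix.transpose_sub, Matrix.diagonal_transpose, bulk_transpose]
  have h1 := schrodinger_mulVec_green (bulk_nonneg hW) hβ (toRoot W)
  have h2 := schrodinger_mulVec_green (bulk_nonneg hW) hβ (toZero W)
  change toRoot W ⬝ᵥ green (bulk W) β (toZero W) = toZero W ⬝ᵥ green (bulk W) β (toRoot W)
  nth_rewrite 1 [← h1]
  nth_rewrite 2 [← h2]
  rw [dotProduct_comm, Matrix.dotProduct_mulVec, ← Matrix.mulVec_transpose, hT]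

/-- The Schur complement formula for the tree sum with respect to the vertex `0`. -/
theorem treeSum_cons (hW : W.IsPositive) (τ : ℝ) (t : Fin n → ℝ) :
    treeSum W (Fin.cons τ t : Fin (n + 1) → ℝ) =
      (Real.exp τ * ∏ k, Real.exp (t k)) ^ 2 *
      ((W s(some 0, none) + bulkConductance W (bulkPotential W τ t)) / Real.exp τ *
        (schrodinger (bulk W) (bulkPotential W τ t)).det) := by
  set β := bulkPotential W τ t with hβdef
  have hβ : β ∈ posPotential (bulk W) := potential_mem _ (source_pos hW τ) t
  set x : Fin (n + 1) → ℝ := fun k => Real.exp ((Fin.cons τ t : Fin (n + 1) → ℝ) k) with hx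
  set y := Real.exp τ with hy
  have hy0 : y ≠ 0 := (Real.exp_pos τ).ne'
  set b := green (bulk W) β (toZero W) with hb
  -- The entry at 0 is chosen so that γ is the potential of the whole field with the weights to the
  -- root as source.
  set γ : Fin (n + 1) → ℝ := Fin.cons
    ((W s(some 0, some 0) * y + ∑ k, toZero W k * Real.exp (t k) + W s(some 0, none)) / y) β with hγ
  set B : Matrix (Fin (n + 1)) (Fin (n + 1)) ℝ := Matrix.of fun k l => W s(some k, some l) with hB
  set H := schrodinger B γ with hH
  have hsym : ∀ k : Fin n, W s(some 0, some k.succ) = toZero W k := fun k => by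
    rw [toZero, Sym2.eq_swap]
  have hM : redLaplacian (edgeFactor W (Fin.cons τ t : Fin (n + 1) → ℝ)) =
      Matrix.diagonal x * H * Matrix.diagonal x := by
    ext k l
    rw [Matrix.mul_diagonal, Matrix.diagonal_mul, hH, schrodinger, Matrix.sub_apply,
      Matrix.diagonal_apply, redLaplacian, Matrix.of_apply, mul_sub, sub_mul]
    congr 1
    · split_ifs with hkl
      · subst hkl
        rw [Fintype.sum_option, Fin.sum_univ_succ]
        refine Fin.cases ?_ (fun k => ?_) k
        · simp only [edgeFactor, Sym2.lift_mk, pin_none, pin_cons_zero, pin_cons_succ, hγ, hx,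
            Fin.cons_zero, hsym, Real.exp_zero, Real.exp_add, ← hy]
          have h3 : ∑ l : Fin n, toZero W l * (y * Real.exp (t l))
              = y * ∑ l, toZero W l * Real.exp (t l) := by
            rw [Finset.mul_sum]
            exact Finset.sum_congr rfl fun l _ => by ring
          rw [h3]
          field_simp
          ring
        · simp only [edgeFactor, Sym2.lift_mk, pin_none, pin_cons_zero, pin_cons_succ, hγ, hx,
            Fin.cons_succ, Real.exp_zero, Real.exp_add, ← hy, hβdef, bulkPotential, potential,
            Pi.add_apply, Pi.smul_apply, smul_eq_mul, Real.exp_sub, Real.exp_neg]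
          have hk := Real.exp_ne_zero (t k)
          have h2 : ∑ l, bulk W k l * (Real.exp (t l) / Real.exp (t k)) =
              (∑ l, W s(some k.succ, some l.succ) * Real.exp (t l)) / Real.exp (t k) := by
            rw [Finset.sum_div]
            exact Finset.sum_congr rfl fun l _ => by rw [bulk, Matrix.of_apply]; ring
          have h3 : ∑ l : Fin n, W s(some k.succ, some l.succ) * (Real.exp (t k) * Real.exp (t l))
              = Real.exp (t k) * ∑ l, W s(some k.succ, some l.succ) * Real.exp (t l) := by
            rw [Finset.mul_sum]
            exact Finset.sum_congr rfl fun l _ => by ring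
          rw [h2, h3, toZero, toRoot]
          field_simp
          ring
      · simp
    · simp only [edgeFactor, Sym2.lift_mk, Real.exp_add, hB, Matrix.of_apply, hx]
      change W s(some k, some l) * (x k * x l) = x k * W s(some k, some l) * x l
      ring
  -- The column (1, b) solves the bulk equations, so only the Schur complement at 0 survives.
  have hv : H.mulVec (Fin.cons 1 b) = Pi.single 0
      ((W s(some 0, none) + bulkConductance W β) / y) := by
    ext k
    rw [hH, schrodinger_mulVec, Fin.sum_univ_succ]
    refine Fin.cases ?_ (fun k => ?_) k
    · simp only [hγ, Fin.cons_zero, Fin.cons_succ, hB, Matrix.of_apply, hsym, Pi.single_eq_same,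
        exp_eq_green hW τ t, mul_add, Finset.sum_add_distrib, bulkConductance, ← hβdef, ← hb, ← hy]
      have : ∑ k, toZero W k * (y * b k) = y * ∑ k, toZero W k * b k := by
        rw [Finset.mul_sum]
        exact Finset.sum_congr rfl fun l _ => by ring
      rw [this]
      field_simp
      ring
    · have h := congrFun (schrodinger_mulVec_green (bulk_nonneg hW) hβ (toZero W)) k
      rw [schrodinger_mulVec] at h
      simp only [hγ, Fin.cons_zero, Fin.cons_succ, hB, Matrix.of_apply,
        Pi.single_eq_of_ne (Fin.succ_ne_zero k)]
      rw [← hb] at h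
      simp only [bulk, Matrix.of_apply, toZero] at h
      linarith
  have hdet : H.det = (W s(some 0, none) + bulkConductance W β) / y *
      (schrodinger (bulk W) β).det := by
    -- Cramer's rule, with 1 as the first coordinate of the solution.
    have h1 : (H.updateCol 0 (H.mulVec (Fin.cons 1 b))).det = H.det := by
      rw [← Matrix.cramer_apply, Matrix.cramer_eq_adjugate_mulVec, Matrix.mulVec_mulVec,
        Matrix.adjugate_mul, Matrix.smul_mulVec, Matrix.one_mulVec]
      simp
    rw [← h1, hv, Matrix.det_succ_column_zero, Fin.sum_univ_succ]
    rw [Finset.sum_eq_zero (fun i _ => by simp)]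
    simp only [Fin.val_zero, pow_zero, one_mul, Matrix.updateCol_self, Pi.single_eq_same, add_zero]
    congr 2
    ext k l
    simp [hH, schrodinger, hB, bulk, hγ, Matrix.diagonal_apply]
  rw [treeSum_eq_det, hM, Matrix.det_mul, Matrix.det_mul, Matrix.det_diagonal, hdet,
    Fin.prod_univ_succ]
  simp only [hx, Fin.cons_zero, Fin.cons_succ, ← hy]
  ring

/-- The density factor which depends on the bulk potential only. -/
def bulkFactor (W : Weights (n + 1)) (β : Fin n → ℝ) : ℝ :=
  Real.exp (-(1 / 2 * ∑ k, β k + 1 / 2 * (∑ k, toZero W k * green (bulk W) β (toZero W) k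
      + ∑ k, toRoot W k * green (bulk W) β (toRoot W) k) + bulkConductance W β
      - (1 / 2 * ∑ k, ∑ l, bulk W k l + ∑ k, toZero W k + ∑ k, toRoot W k)))
    * (Real.sqrt (schrodinger (bulk W) β).det / |(schrodinger (bulk W) β).det|)
    * (1 / Real.sqrt (2 * Real.pi)) ^ n

/-- The terms in e^{-t_k} and e^{t_l - t_k} add up to half the sum of β. The terms in e^{t_k} are
affine in e^τ given β, and their cross terms combine to C(β) cosh τ. -/
theorem energy_cons (hW : W.IsPositive) (τ : ℝ) (t : Fin n → ℝ) :
    1 / 2 * ∑ a : Vertex (n + 1), ∑ b : Vertex (n + 1),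
      W s(a, b) * (Real.cosh (pin (Fin.cons τ t : Fin (n + 1) → ℝ) a
        - pin (Fin.cons τ t : Fin (n + 1) → ℝ) b) - 1) =
    (1 / 2 * ∑ k, bulkPotential W τ t k
      + 1 / 2 * (∑ k, toZero W k * green (bulk W) (bulkPotential W τ t) (toZero W) k
      + ∑ k, toRoot W k * green (bulk W) (bulkPotential W τ t) (toRoot W) k)
      + bulkConductance W (bulkPotential W τ t)
      - (1 / 2 * ∑ k, ∑ l, bulk W k l + ∑ k, toZero W k + ∑ k, toRoot W k))
    + (W s(some 0, none) + bulkConductance W (bulkPotential W τ t)) * (Real.cosh τ - 1) := by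
  set β := bulkPotential W τ t with hβdef
  have hβ : β ∈ posPotential (bulk W) := potential_mem _ (source_pos hW τ) t
  have hs0 : ∀ k : Fin n, W s(some 0, some k.succ) = toZero W k := fun k => by
    rw [toZero, Sym2.eq_swap]
  have hsr : ∀ k : Fin n, W s(none, some k.succ) = toRoot W k := fun k => by
    rw [toRoot, Sym2.eq_swap]
  have h1 : ∑ a : Vertex (n + 1), ∑ b : Vertex (n + 1),
      W s(a, b) * (Real.cosh (pin (Fin.cons τ t : Fin (n + 1) → ℝ) a
        - pin (Fin.cons τ t : Fin (n + 1) → ℝ) b) - 1) =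
      ∑ k, ∑ l, bulk W k l * (Real.cosh (t k - t l) - 1)
      + 2 * ∑ k, toZero W k * (Real.cosh (t k - τ) - 1)
      + 2 * ∑ k, toRoot W k * (Real.cosh (t k) - 1)
      + 2 * (W s(some 0, none) * (Real.cosh τ - 1)) := by
    simp only [Fintype.sum_option, Fin.sum_univ_succ, pin_none, pin_cons_zero, pin_cons_succ,
      hs0, hsr, sub_self, Real.cosh_zero, mul_zero, sub_zero, zero_sub, Real.cosh_neg,
      Finset.sum_add_distrib, zero_add]
    have e1 : ∀ k, Real.cosh (τ - t k) = Real.cosh (t k - τ) := fun k => by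
      rw [← Real.cosh_neg, neg_sub]
    rw [Sym2.eq_swap (a := none) (b := some (0 : Fin (n + 1)))]
    simp only [e1, bulk, Matrix.of_apply, toZero, toRoot]
    ring
  have h2 : ∑ k, ∑ l, bulk W k l * (Real.cosh (t k - t l) - 1) =
      ∑ k, ∑ l, bulk W k l * Real.exp (t l - t k) - ∑ k, ∑ l, bulk W k l := by
    have hswap : ∑ k, ∑ l, bulk W k l * Real.exp (t k - t l) =
        ∑ k, ∑ l, bulk W k l * Real.exp (t l - t k) := by
      rw [Finset.sum_comm]
      refine Finset.sum_congr rfl fun k _ => Finset.sum_congr rfl fun l _ => ?_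
      rw [← Matrix.transpose_apply (bulk W), bulk_transpose]
    have e1 : ∀ k l, bulk W k l * (Real.cosh (t k - t l) - 1) =
        1 / 2 * (bulk W k l * Real.exp (t k - t l)) + 1 / 2 * (bulk W k l * Real.exp (t l - t k))
          - bulk W k l := fun k l => by
      rw [Real.cosh_eq, neg_sub]
      ring
    simp only [e1, Finset.sum_sub_distrib, Finset.sum_add_distrib, ← Finset.mul_sum, hswap]
    ring
  have hy := Real.exp_pos τ
  have h3 : ∑ k, β k = ∑ k, ∑ l, bulk W k l * Real.exp (t l - t k)
      + ∑ k, toRoot W k * Real.exp (-t k) + Real.exp τ * ∑ k, toZero W k * Real.exp (-t k) := by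
    simp only [hβdef, bulkPotential, potential, Finset.sum_add_distrib, Pi.add_apply, Pi.smul_apply,
      smul_eq_mul, add_mul, Finset.mul_sum, mul_assoc]
    ring
  have h4 : ∑ k, toZero W k * (Real.cosh (t k - τ) - 1) =
      1 / 2 * (Real.exp (-τ) * ∑ k, toZero W k * Real.exp (t k))
      + 1 / 2 * (Real.exp τ * ∑ k, toZero W k * Real.exp (-t k)) - ∑ k, toZero W k := by
    simp only [Finset.mul_sum, ← Finset.sum_add_distrib, ← Finset.sum_sub_distrib]
    refine Finset.sum_congr rfl fun k _ => ?_
    rw [Real.cosh_eq, neg_sub, sub_eq_add_neg (t k), sub_eq_add_neg τ, Real.exp_add, Real.exp_add]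
    ring
  have h5 : ∑ k, toRoot W k * (Real.cosh (t k) - 1) =
      1 / 2 * ∑ k, toRoot W k * Real.exp (t k)
      + 1 / 2 * ∑ k, toRoot W k * Real.exp (-t k) - ∑ k, toRoot W k := by
    simp only [Finset.mul_sum, ← Finset.sum_add_distrib, ← Finset.sum_sub_distrib]
    refine Finset.sum_congr rfl fun k _ => ?_
    rw [Real.cosh_eq]
    ring
  have hlin : ∀ q : Fin n → ℝ, ∑ k, q k * Real.exp (t k) =
      ∑ k, q k * green (bulk W) β (toRoot W) k
        + Real.exp τ * ∑ k, q k * green (bulk W) β (toZero W) k := fun q => by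
    simp only [Finset.mul_sum, ← Finset.sum_add_distrib]
    refine Finset.sum_congr rfl fun k _ => ?_
    rw [exp_eq_green hW τ t k, ← hβdef]
    ring
  have h6 : ∑ k, toZero W k * green (bulk W) β (toRoot W) k = bulkConductance W β := rfl
  rw [h1, h2, h4, h5, hlin, hlin, toRoot_dot_green hW hβ, h6, h3, Real.cosh_eq, Real.exp_neg]
  field_simp
  ring

/-- The factor |det H| is split off because the substitution t ↦ β absorbs it. The factor √r of the
single-edge density comes from the Schur complement in the tree sum. -/
theorem density_cons (hW : W.IsPositive) (τ : ℝ) (t : Fin n → ℝ) :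
    density W (Fin.cons τ t : Fin (n + 1) → ℝ) =
      |(schrodinger (bulk W) (bulkPotential W τ t)).det| * (bulkFactor W (bulkPotential W τ t) *
        edgeDensity (W s(some 0, none) + bulkConductance W (bulkPotential W τ t)) τ) := by
  have hβ : bulkPotential W τ t ∈ posPotential (bulk W) := potential_mem _ (source_pos hW τ) t
  have hdet := det_schrodinger_ne_zero (bulk_nonneg hW) hβ
  have hr : 0 < W s(some 0, none) + bulkConductance W (bulkPotential W τ t) :=
    add_pos_of_pos_of_nonneg (hW _ _ (by simp)) (bulkConductance_nonneg hW hβ)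
  rw [density, energy_cons hW, treeSum_cons hW, bulkFactor, edgeDensity]
  set r := W s(some 0, none) + bulkConductance W (bulkPotential W τ t)
  set D := (schrodinger (bulk W) (bulkPotential W τ t)).det
  have hP : 0 < Real.exp τ * ∏ k, Real.exp (t k) :=
    mul_pos (Real.exp_pos _) (Finset.prod_pos fun _ _ => Real.exp_pos _)
  rw [neg_add, Real.exp_add, Real.sqrt_mul (sq_nonneg _), Real.sqrt_sq hP.le,
    Real.sqrt_mul (by positivity), Real.sqrt_div hr.le, Real.sqrt_div hr.le, Fin.prod_univ_succ]
  simp only [Fin.cons_zero, Fin.cons_succ, Finset.prod_div_distrib, Finset.prod_const,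
    Finset.card_univ, Fintype.card_fin]
  have h1 : ∏ k, Real.exp (-t k) = (∏ k, Real.exp (t k))⁻¹ := by
    rw [← Finset.prod_inv_distrib]
    exact Finset.prod_congr rfl fun k _ => Real.exp_neg _
  have h2 : Real.sqrt (Real.exp τ) = Real.exp (τ / 2) := (Real.exp_half τ).symm
  have h3 : Real.exp (-τ / 2) = (Real.exp (τ / 2))⁻¹ := by rw [neg_div, Real.exp_neg]
  rw [h1, h2, h3, Real.exp_neg τ]
  have h4 : 0 < ∏ k, Real.exp (t k) := Finset.prod_pos fun _ _ => Real.exp_pos _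
  have h5 : |D| ≠ 0 := abs_ne_zero.2 hdet
  have h6 : 0 < Real.sqrt (2 * Real.pi) := by positivity
  rw [one_div_pow]
  field_simp

end Block

/-! ### Monotonicity in the weight of the edge between the vertex `0` and the root -/

/-- The field in the exponential coordinates `x_k = e^{t_k}`. -/
def expField {N : ℕ} (t : Fin N → ℝ) : Fin N → ℝ := fun k => Real.exp (t k)

/-- The open positive orthant. -/
def orthant (N : ℕ) : Set (Fin N → ℝ) := {x | ∀ k, 0 < x k}

theorem expField_mem {N : ℕ} (t : Fin N → ℝ) : expField t ∈ orthant N := fun _ => Real.exp_pos _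

theorem continuous_expField {N : ℕ} : Continuous (expField (N := N)) := by
  unfold expField
  fun_prop

theorem continuous_pin {N : ℕ} (a : Vertex N) : Continuous fun t : Fin N → ℝ => pin t a := by
  cases a with
  | none => exact continuous_const
  | some k => exact continuous_apply k

theorem continuous_edgeFactor {N : ℕ} (W : Weights N) (e : Sym2 (Vertex N)) :
    Continuous fun t => edgeFactor W t e := by
  induction e using Sym2.ind with
  | _ a b =>
    simp only [edgeFactor, Sym2.lift_mk]
    exact continuous_const.mul (((continuous_pin a).add (continuous_pin b)).rexp)

theorem continuous_density {N : ℕ} (W : Weights N) : Continuous (density W) := by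
  unfold density treeSum
  have h := continuous_edgeFactor W
  have hp := continuous_pin (N := N)
  refine ((Real.continuous_exp.comp (continuous_const.mul ?_).neg).mul
    (Real.continuous_sqrt.comp ?_)).mul ?_
  · exact continuous_finsetSum _ fun a _ => continuous_finsetSum _ fun b _ =>
      continuous_const.mul ((Real.continuous_cosh.comp ((hp a).sub (hp b))).sub continuous_const)
  · exact continuous_finsetSum _ fun T _ => continuous_finsetProd _ fun e _ => h e
  · fun_prop

theorem density_nonneg {N : ℕ} (W : Weights N) (t : Fin N → ℝ) : 0 ≤ density W t := by
  unfold density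
  positivity

theorem lintegral_tField {N : ℕ} (W : Weights N) {g : (Fin N → ℝ) → ℝ} (hg : Measurable g) :
    ∫⁻ t, ENNReal.ofReal (g t) ∂tField W = ∫⁻ t, ENNReal.ofReal (density W t * g t) := by
  rw [tField, lintegral_withDensity_eq_lintegral_mul _
    (continuous_density W).measurable.ennreal_ofReal hg.ennreal_ofReal]
  refine lintegral_congr fun t => ?_
  rw [Pi.mul_apply, ENNReal.ofReal_mul (density_nonneg W t)]

theorem lintegral_cons {n : ℕ} {g : (Fin (n + 1) → ℝ) → ℝ≥0∞} (hg : Measurable g) :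
    ∫⁻ t, g t = ∫⁻ τ : ℝ, ∫⁻ t : Fin n → ℝ, g (Fin.cons τ t) := by
  have hmp := (volume_preserving_piFinSuccAbove (fun _ : Fin (n + 1) => ℝ) 0).symm
  rw [← hmp.lintegral_comp_emb (MeasurableEquiv.measurableEmbedding _), Measure.volume_eq_prod]
  refine (lintegral_prod _ (hg.comp (MeasurableEquiv.measurable _)).aemeasurable).trans ?_
  refine lintegral_congr fun τ => lintegral_congr fun t => ?_
  exact congrArg g (Fin.insertNth_zero' τ t)

section Line

variable {n : ℕ}

/-- The restriction of `F` to the line on which the field lies when the potential is `β`. -/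
def lineFun (W : Weights (n + 1)) (F : (Fin (n + 1) → ℝ) → ℝ) (β : Fin n → ℝ) (y : ℝ) : ℝ :=
  F (Fin.cons y fun k =>
    green (bulk W) β (toRoot W) k + y * green (bulk W) β (toZero W) k)

variable {W : Weights (n + 1)} {F : (Fin (n + 1) → ℝ) → ℝ}

theorem measurable_lineFun (W : Weights (n + 1)) (hFm : Measurable F) :
    Measurable fun p : ℝ × (Fin n → ℝ) => lineFun W F p.2 p.1 := by
  refine hFm.comp (measurable_pi_iff.2 fun k => ?_)
  refine Fin.cases ?_ (fun k => ?_) k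
  · exact measurable_fst
  · exact ((measurable_green _ _ k).comp measurable_snd).add
      (measurable_fst.mul ((measurable_green _ _ k).comp measurable_snd))

theorem measurable_bulkConductance (W : Weights (n + 1)) : Measurable (bulkConductance W) := by
  unfold bulkConductance
  exact Finset.measurable_fun_sum _ fun k _ => (measurable_green _ _ k).const_mul _

theorem measurable_bulkFactor (W : Weights (n + 1)) : Measurable (bulkFactor W) := by
  unfold bulkFactor
  have h1 := measurable_bulkConductance W
  have h2 := fun r k => measurable_green (bulk W) r k
  have h3 := measurable_det_schrodinger (bulk W)
  have h4 : Measurable fun β => |(schrodinger (bulk W) β).det| := h3.abs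
  refine ((Real.measurable_exp.comp ?_).mul (h3.sqrt.div h4)).mul_const _
  fun_prop

theorem bulkFactor_nonneg (W : Weights (n + 1)) (β : Fin n → ℝ) : 0 ≤ bulkFactor W β := by
  unfold bulkFactor
  positivity

theorem lineFun_nonneg (hW : W.IsPositive) (hF : ∀ x ∈ orthant (n + 1), 0 ≤ F x) {β : Fin n → ℝ}
    (hβ : β ∈ posPotential (bulk W)) {y : ℝ} (hy : 0 < y) : 0 ≤ lineFun W F β y := by
  refine hF _ fun k => ?_
  refine Fin.cases ?_ (fun k => ?_) k
  · exact hy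
  · exact add_pos (green_pos (bulk_nonneg hW) hβ (toRoot_pos hW) k)
      (mul_pos hy (green_pos (bulk_nonneg hW) hβ (toZero_pos hW) k))

theorem convexOn_lineFun (hW : W.IsPositive) (hF : ConvexOn ℝ (orthant (n + 1)) F) {β : Fin n → ℝ}
    (hβ : β ∈ posPotential (bulk W)) : ConvexOn ℝ (Set.Ioi 0) (lineFun W F β) := by
  have hmem : ∀ y : ℝ, 0 < y → (Fin.cons y fun k => green (bulk W) β (toRoot W) k
      + y * green (bulk W) β (toZero W) k : Fin (n + 1) → ℝ) ∈ orthant (n + 1) := by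
    intro y hy k
    refine Fin.cases ?_ (fun k => ?_) k
    · exact hy
    · exact add_pos (green_pos (bulk_nonneg hW) hβ (toRoot_pos hW) k)
        (mul_pos hy (green_pos (bulk_nonneg hW) hβ (toZero_pos hW) k))
  refine ⟨convex_Ioi 0, fun y hy z hz a b ha hb hab => ?_⟩
  have h := hF.2 (hmem y hy) (hmem z hz) ha hb hab
  refine le_of_eq_of_le ?_ h
  rw [lineFun]
  congr 1
  ext k
  refine Fin.cases ?_ (fun k => ?_) k
  · simp
  · simp only [Fin.cons_succ, Pi.add_apply, Pi.smul_apply, smul_eq_mul]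
    linear_combination (-green (bulk W) β (toRoot W) k) * hab

theorem lintegral_tField_eq (hW : W.IsPositive) (hFm : Measurable F) :
    ∫⁻ t, ENNReal.ofReal (F (expField t)) ∂tField W =
      ∫⁻ β in posPotential (bulk W), ENNReal.ofReal (bulkFactor W β) *
        ∫⁻ τ, ENNReal.ofReal (edgeDensity (W s(some 0, none) + bulkConductance W β) τ
          * lineFun W F β (Real.exp τ)) := by
  set G : ℝ → (Fin n → ℝ) → ℝ≥0∞ := fun τ β => ENNReal.ofReal (bulkFactor W β) *
    ENNReal.ofReal (edgeDensity (W s(some 0, none) + bulkConductance W β) τ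
      * lineFun W F β (Real.exp τ))
  have hFe : Measurable fun t => F (expField t) := hFm.comp continuous_expField.measurable
  have hm : Measurable fun p : ℝ × (Fin n → ℝ) =>
      edgeDensity (W s(some 0, none) + bulkConductance W p.2) p.1
        * lineFun W F p.2 (Real.exp p.1) := by
    refine Measurable.mul ?_ ((measurable_lineFun W hFm).comp
      (Measurable.prodMk (Real.measurable_exp.comp measurable_fst) measurable_snd))
    have h1 := measurable_bulkConductance W
    unfold edgeDensity
    fun_prop
  have hGm : Measurable (Function.uncurry G) :=
    ((measurable_bulkFactor W).comp measurable_snd).ennreal_ofReal.mul hm.ennreal_ofReal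
  rw [lintegral_tField W hFe]
  refine (lintegral_cons ((continuous_density W).measurable.mul hFe).ennreal_ofReal).trans ?_
  simp only [Pi.mul_apply]
  have h1 : ∀ τ : ℝ, ∫⁻ t : Fin n → ℝ, ENNReal.ofReal (density W (Fin.cons τ t : Fin (n + 1) → ℝ)
      * F (expField (Fin.cons τ t : Fin (n + 1) → ℝ))) = ∫⁻ β in posPotential (bulk W), G τ β := by
    intro τ
    rw [← lintegral_potential (bulk_nonneg hW) (source_pos hW τ)]
    refine lintegral_congr fun t => ?_
    have hx : F (expField (Fin.cons τ t : Fin (n + 1) → ℝ)) =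
        lineFun W F (bulkPotential W τ t) (Real.exp τ) := by
      rw [lineFun]
      congr 1
      ext k
      refine Fin.cases rfl (fun k => ?_) k
      exact exp_eq_green hW τ t k
    rw [density_cons hW, hx, mul_assoc, ENNReal.ofReal_mul (abs_nonneg _), mul_assoc,
      ENNReal.ofReal_mul (bulkFactor_nonneg _ _)]
    rfl
  simp only [h1]
  -- The exchange makes τ the inner variable at fixed β, where F is seen along a line.
  rw [lintegral_lintegral_swap hGm.aemeasurable]
  refine lintegral_congr fun β => ?_
  exact lintegral_const_mul _ ((hm.comp measurable_prodMk_right).ennreal_ofReal)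

/-- Two systems of weights which differ at most on the edge between `0` and the root. -/
structure SameBulk (W W' : Weights (n + 1)) : Prop where
  bulk_eq : bulk W = bulk W'
  toZero_eq : toZero W = toZero W'
  toRoot_eq : toRoot W = toRoot W'

theorem sameBulk_of_forall {W W' : Weights (n + 1)}
    (h : ∀ e, e ≠ s(some 0, none) → W e = W' e) : SameBulk W W' := by
  constructor
  · ext k l
    exact h _ (by simp)
  · ext k
    exact h _ (by simp)
  · ext k
    exact h _ (by simp [Fin.succ_ne_zero])

theorem lintegral_tField_le_of_convexOn {W' : Weights (n + 1)} (hW : W.IsPositive)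
    (hW' : W'.IsPositive) (hs : SameBulk W W') (hle : W s(some 0, none) ≤ W' s(some 0, none))
    (hFm : Measurable F) (hF0 : ∀ x ∈ orthant (n + 1), 0 ≤ F x)
    (hF : ConvexOn ℝ (orthant (n + 1)) F) :
    ∫⁻ t, ENNReal.ofReal (F (expField t)) ∂tField W' ≤
      ∫⁻ t, ENNReal.ofReal (F (expField t)) ∂tField W := by
  rw [lintegral_tField_eq hW hFm, lintegral_tField_eq hW' hFm]
  -- The two integrals now differ only in the weight of the single edge.
  simp only [bulkFactor, bulkConductance, lineFun, ← hs.bulk_eq, ← hs.toZero_eq, ← hs.toRoot_eq]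
  refine setLIntegral_mono' (measurableSet_posPotential (bulk_nonneg hW)) fun β hβ => ?_
  refine mul_le_mul_right ?_ _
  refine lintegral_edgeDensity_antitone ((measurable_lineFun W hFm).comp measurable_prodMk_right)
    (fun y hy => lineFun_nonneg hW hF0 hβ hy) (convexOn_lineFun hW hF hβ) ?_ (by gcongr)
  exact add_pos_of_pos_of_nonneg (hW _ _ (by simp)) (bulkConductance_nonneg hW hβ)

theorem lintegral_tField_le_of_concaveOn {W' : Weights (n + 1)} (hW : W.IsPositive)
    (hW' : W'.IsPositive) (hs : SameBulk W W') (hle : W s(some 0, none) ≤ W' s(some 0, none))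
    (hFm : Measurable F) (hF0 : ∀ x ∈ orthant (n + 1), 0 ≤ F x)
    (hF : ConcaveOn ℝ (orthant (n + 1)) F) :
    ∫⁻ t, ENNReal.ofReal (F (expField t)) ∂tField W ≤
      ∫⁻ t, ENNReal.ofReal (F (expField t)) ∂tField W' := by
  rw [lintegral_tField_eq hW hFm, lintegral_tField_eq hW' hFm]
  simp only [bulkFactor, bulkConductance, lineFun, ← hs.bulk_eq, ← hs.toZero_eq, ← hs.toRoot_eq]
  refine setLIntegral_mono' (measurableSet_posPotential (bulk_nonneg hW)) fun β hβ => ?_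
  refine mul_le_mul_right ?_ _
  refine lintegral_edgeDensity_monotone ((measurable_lineFun W hFm).comp measurable_prodMk_right)
    (fun y hy => lineFun_nonneg hW hF0 hβ hy)
    (neg_convexOn_iff.1 (convexOn_lineFun hW hF.neg hβ)) ?_ (by gcongr)
  exact add_pos_of_pos_of_nonneg (hW _ _ (by simp)) (bulkConductance_nonneg hW hβ)

end Line

/-! ### Changing the root -/

section Relabel

variable {N : ℕ}

/-- The weights after a relabelling of the vertices. -/
def relabelWeights (σ : Equiv.Perm (Vertex N)) (W : Weights N) : Weights N :=
  fun e => W (e.map σ)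

/-- The field after a relabelling of the vertices, pinned at the new root. -/
def relabelField (σ : Equiv.Perm (Vertex N)) : (Fin N → ℝ) →ₗ[ℝ] (Fin N → ℝ) where
  toFun t k := pin t (σ (some k)) - pin t (σ none)
  map_add' t u := by
    have h : ∀ a, pin (t + u) a = pin t a + pin u a := fun a => by
      cases a <;> simp [pin]
    ext k
    simp only [h, Pi.add_apply]
    ring
  map_smul' c t := by
    have h : ∀ a, pin (c • t) a = c * pin t a := fun a => by
      cases a <;> simp [pin]
    ext k
    simp only [h, Pi.smul_apply, smul_eq_mul, RingHom.id_apply]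
    ring

theorem pin_relabelField (σ : Equiv.Perm (Vertex N)) (t : Fin N → ℝ) (a : Vertex N) :
    pin (relabelField σ t) a = pin t (σ a) - pin t (σ none) := by
  cases a with
  | none => simp [pin]
  | some k => rfl

theorem edgeFactor_relabel (σ : Equiv.Perm (Vertex N)) (W : Weights N) (t : Fin N → ℝ)
    (e : Sym2 (Vertex N)) : edgeFactor (relabelWeights σ W) (relabelField σ t) e =
      Real.exp (-pin t (σ none)) ^ 2 * edgeFactor W t (e.map σ) := by
  induction e using Sym2.ind with
  | _ a b =>
    simp only [edgeFactor, relabelWeights, Sym2.map_mk, Sym2.lift_mk, pin_relabelField, Real.exp_add,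
      sub_eq_add_neg]
    ring

/-- A spanning tree has N edges, and each contributes the square of e^{-t_{σδ}}. -/
theorem treeSum_relabel (σ : Equiv.Perm (Vertex N)) (W : Weights N) (t : Fin N → ℝ) :
    treeSum (relabelWeights σ W) (relabelField σ t) =
      (Real.exp (-pin t (σ none)) ^ N) ^ 2 * treeSum W t := by
  classical
  rw [treeSum, treeSum, Finset.mul_sum]
  refine Finset.sum_equiv σ.simpleGraph ?_ ?_
  · intro T
    simp only [Finset.mem_filter, Finset.mem_univ, true_and]
    exact (SimpleGraph.Iso.comap σ.symm T).symm.isTree_iff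
  · intro T hT
    have hT : T.IsTree := (Finset.mem_filter.1 hT).2
    have hcard : (Finset.univ.filter fun e => e ∈ T.edgeSet).card = N := by
      have h := hT.card_edgeFinset
      simp only [Fintype.card_option, Fintype.card_fin] at h
      refine Eq.trans ?_ (Nat.succ_injective h)
      congr 1
      ext e
      simp
    have hmem : ∀ e, e ∈ T.edgeSet ↔ e.map σ ∈ (σ.simpleGraph T).edgeSet := by
      intro e
      induction e using Sym2.ind with
      | _ a b => simp [Equiv.simpleGraph]
    simp only [edgeFactor_relabel, Finset.prod_mul_distrib, Finset.prod_const]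
    congr 1
    · convert (pow_right_comm _ 2 N) using 2
    · refine Finset.prod_nbij' (fun e => e.map σ) (fun e => e.map σ.symm) ?_ ?_ ?_ ?_ ?_
      · intro e he
        exact Finset.mem_filter.2 ⟨Finset.mem_univ _, (hmem e).1 (Finset.mem_filter.1 he).2⟩
      · intro e he
        simpa [hmem, Sym2.map_map] using he
      · intro e _
        simp [Sym2.map_map]
      · intro e _
        simp [Sym2.map_map]
      · intro e _
        rfl

/-- With a = t_{σδ}, the root of the tree sum gives e^{-Na} and the product of the e^{-t_k} gives
e^{(N+1)a}; the energy depends on differences only. -/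
theorem density_relabel (σ : Equiv.Perm (Vertex N)) (W : Weights N) (t : Fin N → ℝ) :
    density (relabelWeights σ W) (relabelField σ t) = Real.exp (pin t (σ none)) * density W t := by
  have hE : ∑ a : Vertex N, ∑ b : Vertex N, relabelWeights σ W s(a, b) *
      (Real.cosh (pin (relabelField σ t) a - pin (relabelField σ t) b) - 1) =
      ∑ a : Vertex N, ∑ b : Vertex N, W s(a, b) * (Real.cosh (pin t a - pin t b) - 1) := by
    rw [← Equiv.sum_comp σ fun a => ∑ b : Vertex N, W s(a, b) *
      (Real.cosh (pin t a - pin t b) - 1)]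
    refine Finset.sum_congr rfl fun a _ => ?_
    rw [← Equiv.sum_comp σ fun b => W s(σ a, b) * (Real.cosh (pin t (σ a) - pin t b) - 1)]
    refine Finset.sum_congr rfl fun b _ => ?_
    rw [pin_relabelField, pin_relabelField, sub_sub_sub_cancel_right]
    rfl
  have hsum : ∑ k, relabelField σ t k = ∑ k, t k - (N + 1) * pin t (σ none) := by
    have h1 : ∀ u : Fin N → ℝ, ∑ k, u k = ∑ a : Vertex N, pin u a := fun u => by
      rw [Fintype.sum_option]
      simp [pin]
    rw [h1, h1]
    simp only [pin_relabelField, Finset.sum_sub_distrib]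
    rw [Equiv.sum_comp σ]
    simp
  have hprod : ∀ u : Fin N → ℝ, ∏ k, (Real.exp (-u k) / Real.sqrt (2 * Real.pi)) =
      Real.exp (-∑ k, u k) / Real.sqrt (2 * Real.pi) ^ N := fun u => by
    rw [Finset.prod_div_distrib, ← Real.exp_sum, Finset.sum_neg_distrib]
    simp
  rw [density, density, hE, treeSum_relabel, Real.sqrt_mul (sq_nonneg _),
    Real.sqrt_sq (by positivity), hprod, hprod, hsum, ← Real.exp_nat_mul]
  have h2 : Real.exp (-(∑ k, t k - (N + 1) * pin t (σ none))) =
      Real.exp (-∑ k, t k) * (Real.exp (N * pin t (σ none)) * Real.exp (pin t (σ none))) := by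
    rw [← Real.exp_add, ← Real.exp_add]
    ring_nf
  have h3 : Real.exp (N * -pin t (σ none)) * Real.exp (N * pin t (σ none)) = 1 := by
    rw [← Real.exp_add, mul_neg, neg_add_cancel, Real.exp_zero]
  rw [h2]
  set E := Real.exp (-(1 / 2 * ∑ a : Vertex N, ∑ b : Vertex N,
    W s(a, b) * (Real.cosh (pin t a - pin t b) - 1)))
  linear_combination (E * Real.sqrt (treeSum W t) * Real.exp (-∑ k, t k) *
    Real.exp (pin t (σ none)) / Real.sqrt (2 * Real.pi) ^ N) * h3

theorem relabelField_involutive {σ : Equiv.Perm (Vertex N)} (hσ : Function.Involutive σ)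
    (t : Fin N → ℝ) : relabelField σ (relabelField σ t) = t := by
  ext k
  change pin (relabelField σ t) (σ (some k)) - pin (relabelField σ t) (σ none) = t k
  rw [pin_relabelField, pin_relabelField, hσ, hσ]
  simp [pin]

/-- A linear involution has determinant ±1. -/
theorem measurePreserving_relabelField {σ : Equiv.Perm (Vertex N)} (hσ : Function.Involutive σ) :
    MeasurePreserving (relabelField σ) := by
  have h1 : LinearMap.det (relabelField σ) * LinearMap.det (relabelField σ) = 1 := by
    rw [← LinearMap.det_comp, show relabelField σ ∘ₗ relabelField σ = LinearMap.id from
      LinearMap.ext (relabelField_involutive hσ), LinearMap.det_id]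
  have h2 : LinearMap.det (relabelField σ) ≠ 0 := left_ne_zero_of_mul_eq_one h1
  refine ⟨(relabelField σ).continuous_of_finiteDimensional.measurable, ?_⟩
  rw [Real.map_linearMap_volume_pi_eq_smul_volume_pi h2]
  rcases mul_self_eq_one_iff.1 h1 with h | h <;> simp [h]

/-- The extension of the exponential coordinates to all vertices, with the value `1` at the
root. -/
def pinOne (x : Fin N → ℝ) : Vertex N → ℝ
  | none => 1
  | some k => x k

/-- The perspective of `F` which corresponds to a relabelling of the vertices. -/
def perspective (σ : Equiv.Perm (Vertex N)) (F : (Fin N → ℝ) → ℝ) (x : Fin N → ℝ) : ℝ :=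
  pinOne x (σ none) * F fun k => pinOne x (σ (some k)) / pinOne x (σ none)

theorem pinOne_expField (t : Fin N → ℝ) (a : Vertex N) :
    pinOne (expField t) a = Real.exp (pin t a) := by
  cases a with
  | none => exact Real.exp_zero.symm
  | some k => rfl

theorem pinOne_pos {x : Fin N → ℝ} (hx : x ∈ orthant N) (a : Vertex N) : 0 < pinOne x a := by
  cases a with
  | none => exact one_pos
  | some k => exact hx k

theorem measurable_pinOne (a : Vertex N) : Measurable fun x : Fin N → ℝ => pinOne x a := by
  cases a with
  | none => exact measurable_const
  | some k => exact measurable_pi_apply k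

theorem measurable_perspective (σ : Equiv.Perm (Vertex N)) {F : (Fin N → ℝ) → ℝ}
    (hF : Measurable F) : Measurable (perspective σ F) :=
  (measurable_pinOne _).mul (hF.comp (measurable_pi_iff.2 fun _ =>
    (measurable_pinOne _).div (measurable_pinOne _)))

theorem perspective_nonneg (σ : Equiv.Perm (Vertex N)) {F : (Fin N → ℝ) → ℝ}
    (hF : ∀ x ∈ orthant N, 0 ≤ F x) {x : Fin N → ℝ} (hx : x ∈ orthant N) :
    0 ≤ perspective σ F x :=
  mul_nonneg (pinOne_pos hx _).le (hF _ fun _ => div_pos (pinOne_pos hx _) (pinOne_pos hx _))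

theorem convex_orthant : Convex ℝ (orthant N) := by
  intro x hx y hy a b ha hb hab k
  exact convex_Ioi (0 : ℝ) (hx k) (hy k) ha hb hab

theorem convexOn_perspective (σ : Equiv.Perm (Vertex N)) {F : (Fin N → ℝ) → ℝ}
    (hF : ConvexOn ℝ (orthant N) F) : ConvexOn ℝ (orthant N) (perspective σ F) := by
  refine ⟨convex_orthant, fun x hx y hy a b ha hb hab => ?_⟩
  have hlin : ∀ c, pinOne (a • x + b • y) c = a * pinOne x c + b * pinOne y c := fun c => by
    cases c with
    | none => simp [pinOne, hab]
    | some k => rfl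
  have hs := pinOne_pos (convex_orthant hx hy ha hb hab) (σ none)
  have hs1 := pinOne_pos hx (σ none)
  have hs2 := pinOne_pos hy (σ none)
  set s := pinOne (a • x + b • y) (σ none) with hsdef
  set s₁ := pinOne x (σ none)
  set s₂ := pinOne y (σ none)
  have hsum : s = a * s₁ + b * s₂ := hlin _
  have h := hF.2 (x := fun k => pinOne x (σ (some k)) / s₁)
    (fun k => div_pos (pinOne_pos hx _) hs1) (y := fun k => pinOne y (σ (some k)) / s₂)
    (fun k => div_pos (pinOne_pos hy _) hs2)
    (show 0 ≤ a * s₁ / s by positivity) (show 0 ≤ b * s₂ / s by positivity)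
    (by rw [← add_div, ← hsum, div_self hs.ne'])
  have harg : (a * s₁ / s) • (fun k => pinOne x (σ (some k)) / s₁)
      + (b * s₂ / s) • (fun k => pinOne y (σ (some k)) / s₂) =
      fun k => pinOne (a • x + b • y) (σ (some k)) / s := by
    ext k
    simp only [Pi.add_apply, Pi.smul_apply, smul_eq_mul, hlin]
    field_simp
  rw [harg] at h
  calc perspective σ F (a • x + b • y)
      = s * F fun k => pinOne (a • x + b • y) (σ (some k)) / s := rfl
    _ ≤ s * _ := mul_le_mul_of_nonneg_left h hs.le
    _ = a • perspective σ F x + b • perspective σ F y := by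
        simp only [smul_eq_mul, perspective]
        field_simp
        rfl

/-- The extra exponential in the density is the outer factor of the perspective, and re-pinning the
field divides its arguments by the same factor. -/
theorem lintegral_tField_relabel {σ : Equiv.Perm (Vertex N)} (hσ : Function.Involutive σ)
    (W : Weights N) {F : (Fin N → ℝ) → ℝ} (hF : Measurable F) :
    ∫⁻ t, ENNReal.ofReal (F (expField t)) ∂tField W =
      ∫⁻ t, ENNReal.ofReal (perspective σ F (expField t)) ∂tField (relabelWeights σ W) := by
  have he := continuous_expField (N := N)
  have hFe : Measurable fun t => F (expField t) := hF.comp he.measurable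
  have hPe : Measurable fun t => perspective σ F (expField t) :=
    (measurable_perspective σ hF).comp he.measurable
  rw [lintegral_tField W hFe, lintegral_tField _ hPe]
  refine ((measurePreserving_relabelField hσ).lintegral_comp
    ((continuous_density W).measurable.mul hFe).ennreal_ofReal).symm.trans ?_
  refine lintegral_congr fun t => ?_
  have h1 := density_relabel σ W (relabelField σ t)
  rw [relabelField_involutive hσ, pin_relabelField, hσ] at h1
  have h2 : expField (relabelField σ t) =
      fun k => pinOne (expField t) (σ (some k)) / pinOne (expField t) (σ none) := by
    ext k
    rw [pinOne_expField, pinOne_expField, ← Real.exp_sub]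
    rfl
  have h3 : Real.exp (pin t (σ none)) * Real.exp (pin t none - pin t (σ none)) = 1 := by
    rw [← Real.exp_add]
    simp [pin]
  rw [← pinOne_expField] at h3
  rw [Pi.mul_apply, h1, h2, perspective]
  congr 1
  linear_combination (-density W (relabelField σ t) * F fun k =>
    pinOne (expField t) (σ (some k)) / pinOne (expField t) (σ none)) * h3

/-- The measure decreases in the convex order, tested on nonnegative functions, as the weight of
the edge between `p` and `q` increases. -/
def EdgeMonotone (N : ℕ) (p q : Vertex N) : Prop :=
  ∀ W W' : Weights N, W.IsPositive → W'.IsPositive → (∀ e, e ≠ s(p, q) → W e = W' e) →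
    W s(p, q) ≤ W' s(p, q) → ∀ F : (Fin N → ℝ) → ℝ, Measurable F → (∀ x ∈ orthant N, 0 ≤ F x) →
    (ConvexOn ℝ (orthant N) F →
      ∫⁻ t, ENNReal.ofReal (F (expField t)) ∂tField W' ≤
        ∫⁻ t, ENNReal.ofReal (F (expField t)) ∂tField W) ∧
    (ConcaveOn ℝ (orthant N) F →
      ∫⁻ t, ENNReal.ofReal (F (expField t)) ∂tField W ≤
        ∫⁻ t, ENNReal.ofReal (F (expField t)) ∂tField W')

theorem edgeMonotone_zero_root (n : ℕ) : EdgeMonotone (n + 1) (some 0) none :=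
  fun _ _ hW hW' hs hle _ hFm hF0 =>
    ⟨lintegral_tField_le_of_convexOn hW hW' (sameBulk_of_forall hs) hle hFm hF0,
      lintegral_tField_le_of_concaveOn hW hW' (sameBulk_of_forall hs) hle hFm hF0⟩

theorem EdgeMonotone.relabel {σ : Equiv.Perm (Vertex N)} (hσ : Function.Involutive σ)
    {p q : Vertex N} (h : EdgeMonotone N p q) : EdgeMonotone N (σ p) (σ q) := by
  intro W W' hW hW' hs hle F hFm hF0
  have hpos : ∀ U : Weights N, U.IsPositive → (relabelWeights σ U).IsPositive :=
    fun U hU a b hab => hU _ _ (σ.injective.ne hab)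
  rw [lintegral_tField_relabel hσ W hFm, lintegral_tField_relabel hσ W' hFm]
  have h1 := h (relabelWeights σ W) (relabelWeights σ W') (hpos W hW) (hpos W' hW')
    (fun e he => hs _ fun h2 => he (Sym2.map.injective σ.injective h2)) hle
    (perspective σ F) (measurable_perspective σ hFm) (fun x hx => perspective_nonneg σ hF0 hx)
  refine ⟨fun hc => h1.1 (convexOn_perspective σ hc), fun hc => h1.2 ?_⟩
  have h2 := convexOn_perspective σ hc.neg
  have h3 : perspective σ (-F) = -perspective σ F := by
    ext x
    simp [perspective]
  rw [h3] at h2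
  exact neg_convexOn_iff.1 h2

theorem edgeMonotone_of_ne {n : ℕ} {p q : Vertex (n + 1)} (hpq : p ≠ q) :
    EdgeMonotone (n + 1) p q := by
  have hinv : ∀ a b : Vertex (n + 1), Function.Involutive (Equiv.swap a b) :=
    fun a b c => Equiv.swap_apply_self a b c
  have h1 := (edgeMonotone_zero_root n).relabel (hinv none q)
  rw [Equiv.swap_apply_left] at h1
  have hne : q ≠ Equiv.swap none q (some 0) := fun h => by
    have h2 := congrArg (Equiv.swap none q) h
    rw [Equiv.swap_apply_right, Equiv.swap_apply_self] at h2
    exact Option.some_ne_none _ h2.symm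
  -- The first transposition has brought the root to q; this one brings the other endpoint to p and
  -- fixes q.
  have h2 := h1.relabel (hinv (Equiv.swap none q (some 0)) p)
  rwa [Equiv.swap_apply_left, Equiv.swap_apply_of_ne_of_ne hne hpq.symm] at h2

end Relabel

/-! ### Integrability -/

theorem one_add_sq_div_two_le_cosh (s : ℝ) : 1 + s ^ 2 / 2 ≤ Real.cosh s := by
  have h1 : Real.cosh s = 1 + 2 * Real.sinh (s / 2) ^ 2 := by
    have := Real.cosh_two_mul (s / 2)
    rw [mul_div_cancel₀ _ (two_ne_zero' ℝ)] at this
    rw [this, Real.cosh_sq]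
    ring
  have h2 : (s / 2) ^ 2 ≤ Real.sinh (s / 2) ^ 2 := by
    rw [sq_le_sq, Real.abs_sinh]
    exact Real.self_le_sinh_iff.2 (abs_nonneg _)
  rw [h1]
  linarith [div_pow s 2 2]

theorem integrable_exp_abs_sub_cosh (m : ℝ) {w : ℝ} (hw : 0 < w) :
    Integrable fun s : ℝ => Real.exp (m * |s| - w * (Real.cosh s - 1)) := by
  have h := (integrable_exp_neg_mul_sq (b := w / 4) (by positivity)).const_mul (Real.exp (m ^ 2 / w))
  refine h.mono' (by fun_prop) (Filter.Eventually.of_forall fun s => ?_)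
  rw [Real.norm_eq_abs, Real.abs_exp, ← Real.exp_add]
  refine Real.exp_le_exp.2 ?_
  have h1 := mul_le_mul_of_nonneg_left (one_add_sq_div_two_le_cosh s) hw.le
  have h2 : m * |s| ≤ w / 4 * s ^ 2 + m ^ 2 / w := by
    have h3 : 0 ≤ (w / 2 * |s| - m) ^ 2 / w := by positivity
    have h4 : (w / 2 * |s| - m) ^ 2 / w = w / 4 * |s| ^ 2 + m ^ 2 / w - m * |s| := by
      field_simp
      ring
    rw [sq_abs] at h4
    linarith
  linarith

variable {N : ℕ}

theorem pin_le_sum_abs (t : Fin N → ℝ) (a : Vertex N) : pin t a ≤ ∑ k, |t k| := by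
  cases a with
  | none => exact Finset.sum_nonneg fun k _ => abs_nonneg _
  | some k =>
    exact (le_abs_self _).trans
      (Finset.single_le_sum (f := fun k => |t k|) (fun k _ => abs_nonneg _) (Finset.mem_univ k))

theorem abs_edgeFactor_le (W : Weights N) (t : Fin N → ℝ) (e : Sym2 (Vertex N)) :
    |edgeFactor W t e| ≤ |W e| * Real.exp (2 * ∑ k, |t k|) := by
  induction e using Sym2.ind with
  | _ a b =>
    rw [edgeFactor, abs_mul, Sym2.lift_mk, Real.abs_exp]
    have h1 := pin_le_sum_abs t a
    have h2 := pin_le_sum_abs t b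
    gcongr
    linarith

/-- The exponential is squared so that it leaves the square root in the density cleanly. -/
theorem exists_treeSum_le (W : Weights N) : ∃ C : ℝ, 0 ≤ C ∧ ∃ M : ℕ, ∀ t,
    treeSum W t ≤ C * Real.exp (M * ∑ k, |t k|) ^ 2 := by
  classical
  refine ⟨∑ T : SimpleGraph (Vertex N) with T.IsTree,
    ∏ e : Sym2 (Vertex N) with e ∈ T.edgeSet, |W e|,
    Finset.sum_nonneg fun T _ => Finset.prod_nonneg fun e _ => abs_nonneg _,
    Fintype.card (Sym2 (Vertex N)), fun t => ?_⟩
  have hS : 0 ≤ ∑ k, |t k| := Finset.sum_nonneg fun k _ => abs_nonneg _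
  rw [treeSum, Finset.sum_mul]
  refine Finset.sum_le_sum fun T _ => (le_abs_self _).trans ?_
  rw [Finset.abs_prod]
  refine (Finset.prod_le_prod (fun e _ => abs_nonneg _)
    fun e _ => abs_edgeFactor_le W t e).trans ?_
  rw [Finset.prod_mul_distrib, Finset.prod_const]
  refine mul_le_mul_of_nonneg_left ?_ (Finset.prod_nonneg fun e _ => abs_nonneg _)
  rw [← Real.exp_nat_mul, ← Real.exp_nat_mul]
  refine Real.exp_le_exp.2 ?_
  have h1 : ((Finset.univ.filter fun e : Sym2 (Vertex N) => e ∈ T.edgeSet).card : ℝ) ≤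
      Fintype.card (Sym2 (Vertex N)) := by
    exact_mod_cast Finset.card_le_univ _
  push_cast
  calc _ ≤ (Fintype.card (Sym2 (Vertex N)) : ℝ) * (2 * ∑ k, |t k|) := by
        convert mul_le_mul_of_nonneg_right h1 (show 0 ≤ 2 * ∑ k, |t k| by positivity)
    _ = _ := by ring

theorem energy_ge {W : Weights N} (hW : W.IsPositive) (t : Fin N → ℝ) :
    ∑ k, W s(some k, none) * (Real.cosh (t k) - 1) ≤
      1 / 2 * ∑ a : Vertex N, ∑ b : Vertex N,
        W s(a, b) * (Real.cosh (pin t a - pin t b) - 1) := by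
  have h0 : ∀ a b : Vertex N, 0 ≤ W s(a, b) * (Real.cosh (pin t a - pin t b) - 1) := by
    intro a b
    rcases eq_or_ne a b with rfl | hab
    · simp
    · exact mul_nonneg (hW a b hab).le (sub_nonneg.2 (Real.one_le_cosh _))
  have h1 : ∀ k, W s(none, some k) * (Real.cosh (pin t none - pin t (some k)) - 1) =
      W s(some k, none) * (Real.cosh (t k) - 1) := fun k => by
    rw [Sym2.eq_swap, ← Real.cosh_neg]
    simp [pin]
  have h2 : ∀ k, W s(some k, none) * (Real.cosh (pin t (some k) - pin t none) - 1) =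
      W s(some k, none) * (Real.cosh (t k) - 1) := fun k => by
    simp [pin]
  simp only [Fintype.sum_option, h1, h2, Finset.sum_add_distrib]
  have h3 := h0 none none
  have h4 : 0 ≤ ∑ k : Fin N, ∑ l : Fin N, W s(some k, some l) *
      (Real.cosh (pin t (some k) - pin t (some l)) - 1) :=
    Finset.sum_nonneg fun k _ => Finset.sum_nonneg fun l _ => h0 _ _
  linarith

theorem integrable_density_mul_exp {W : Weights N} (hW : W.IsPositive) :
    Integrable fun t => density W t * Real.exp (∑ k, |t k|) := by
  obtain ⟨C, hC, M, hM⟩ := exists_treeSum_le W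
  -- In M + 2, the tree sum accounts for M, the factors e^{-t_k} for one unit and the test function
  -- for the other.
  have h1 : Integrable fun t : Fin N → ℝ => ∏ k, Real.exp
      ((M + 2 : ℝ) * |t k| - W s(some k, none) * (Real.cosh (t k) - 1)) :=
    Integrable.fintype_prod (f := fun k (s : ℝ) => Real.exp
      ((M + 2 : ℝ) * |s| - W s(some k, none) * (Real.cosh s - 1)))
      fun k => integrable_exp_abs_sub_cosh _ (hW _ _ (by simp))
  refine (h1.const_mul (Real.sqrt C * (1 / Real.sqrt (2 * Real.pi)) ^ N)).mono'
    ((continuous_density W).mul (by fun_prop)).aestronglyMeasurable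
    (Filter.Eventually.of_forall fun t => ?_)
  rw [Real.norm_of_nonneg (mul_nonneg (density_nonneg W t) (Real.exp_pos _).le)]
  set S := ∑ k, |t k| with hS
  have h2 : Real.sqrt (treeSum W t) ≤ Real.sqrt C * Real.exp (M * S) := by
    refine (Real.sqrt_le_sqrt (hM t)).trans (le_of_eq ?_)
    rw [Real.sqrt_mul hC, Real.sqrt_sq (Real.exp_pos _).le]
  have h3 : ∏ k, (Real.exp (-t k) / Real.sqrt (2 * Real.pi)) ≤
      Real.exp S * (1 / Real.sqrt (2 * Real.pi)) ^ N := by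
    rw [Finset.prod_div_distrib, ← Real.exp_sum, Finset.prod_const, Finset.card_univ,
      Fintype.card_fin, div_eq_mul_one_div, ← one_div_pow]
    gcongr
    exact Finset.sum_le_sum fun k _ => neg_le_abs (t k)
  have h4 : ∏ k, Real.exp ((M + 2 : ℝ) * |t k| - W s(some k, none) * (Real.cosh (t k) - 1)) =
      Real.exp (-∑ k, W s(some k, none) * (Real.cosh (t k) - 1))
        * Real.exp (M * S) * Real.exp S * Real.exp S := by
    rw [← Real.exp_sum, ← Real.exp_add, ← Real.exp_add, ← Real.exp_add, Finset.sum_sub_distrib,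
      ← Finset.mul_sum, ← hS]
    ring_nf
  have h5 : Real.exp (-(1 / 2 * ∑ a : Vertex N, ∑ b : Vertex N,
      W s(a, b) * (Real.cosh (pin t a - pin t b) - 1))) ≤
      Real.exp (-∑ k, W s(some k, none) * (Real.cosh (t k) - 1)) :=
    Real.exp_le_exp.2 (neg_le_neg (energy_ge hW t))
  calc density W t * Real.exp S
      ≤ Real.exp (-∑ k, W s(some k, none) * (Real.cosh (t k) - 1))
        * (Real.sqrt C * Real.exp (M * S))
        * (Real.exp S * (1 / Real.sqrt (2 * Real.pi)) ^ N) * Real.exp S := by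
        unfold density
        gcongr
    _ = _ := by
        rw [h4]
        ring

theorem integrable_exp_sum_abs {W : Weights N} (hW : W.IsPositive) :
    Integrable (fun t : Fin N → ℝ => Real.exp (∑ k, |t k|)) (tField W) := by
  have hc : Continuous fun t : Fin N → ℝ => Real.exp (∑ k, |t k|) := by fun_prop
  rw [← lintegral_ofReal_ne_top_iff_integrable hc.aestronglyMeasurable
    (Filter.Eventually.of_forall fun t => (Real.exp_pos _).le), lintegral_tField W hc.measurable]
  exact (integrable_density_mul_exp hW).lintegral_lt_top.ne

theorem integrable_one {W : Weights N} (hW : W.IsPositive) :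
    Integrable (fun _ : Fin N → ℝ => (1 : ℝ)) (tField W) := by
  refine (integrable_exp_sum_abs hW).mono' aestronglyMeasurable_const
    (Filter.Eventually.of_forall fun t => ?_)
  rw [norm_one]
  exact Real.one_le_exp (Finset.sum_nonneg fun k _ => abs_nonneg _)

theorem integrable_expField {W : Weights N} (hW : W.IsPositive) (k : Fin N) :
    Integrable (fun t : Fin N → ℝ => expField t k) (tField W) := by
  refine (integrable_exp_sum_abs hW).mono'
    ((continuous_apply k).comp continuous_expField).aestronglyMeasurable
    (Filter.Eventually.of_forall fun t => ?_)
  rw [expField, Real.norm_eq_abs, Real.abs_exp]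
  exact Real.exp_le_exp.2 (pin_le_sum_abs t (some k))

/-! ### The extended integral of a convex function -/

/-- If P has infinite integral, the negative part of P + L is still dominated by that of L, so both
sides are +∞. -/
theorem extIntegral_add {X : Type*} [MeasurableSpace X] {μ : Measure X} {P L : X → ℝ}
    (hPm : Measurable P) (hP : ∀ x, 0 ≤ P x) (hL : Integrable L μ) :
    extIntegral μ (fun x => P x + L x) =
      ((∫⁻ x, ENNReal.ofReal (P x) ∂μ : ℝ≥0∞) : EReal) + ((∫ x, L x ∂μ : ℝ) : EReal) := by
  by_cases htop : ∫⁻ x, ENNReal.ofReal (P x) ∂μ = ⊤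
  · have hneg : ∫⁻ x, ENNReal.ofReal (-(P x + L x)) ∂μ ≠ ⊤ :=
      ((lintegral_mono fun x => ENNReal.ofReal_le_ofReal
        (show -(P x + L x) ≤ -L x by linarith [hP x])).trans_lt hL.neg.lintegral_lt_top).ne
    have hpos : ∫⁻ x, ENNReal.ofReal (P x + L x) ∂μ = ⊤ := by
      have h1 : ∫⁻ x, ENNReal.ofReal (P x) ∂μ ≤
          ∫⁻ x, ENNReal.ofReal (P x + L x) ∂μ + ∫⁻ x, ENNReal.ofReal (-L x) ∂μ := by
        have hm : AEMeasurable (fun x => ENNReal.ofReal (-L x)) μ :=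
          hL.neg.aemeasurable.ennreal_ofReal
        rw [← lintegral_add_right' _ hm]
        refine lintegral_mono fun x => ?_
        refine le_trans (le_of_eq ?_) ENNReal.ofReal_add_le
        congr 1
        ring
      rw [htop, top_le_iff, ENNReal.add_eq_top] at h1
      exact h1.resolve_right hL.neg.lintegral_lt_top.ne
    rw [extIntegral, htop, hpos, EReal.coe_ennreal_top, EReal.top_add_coe]
    lift (∫⁻ x, ENNReal.ofReal (-(P x + L x)) ∂μ) to NNReal using hneg with r
    rfl
  · have hPi : Integrable P μ := (lintegral_ofReal_ne_top_iff_integrable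
      hPm.aestronglyMeasurable (Filter.Eventually.of_forall hP)).1 htop
    refine (extIntegral_eq_integral (hPi.add hL)).trans ?_
    rw [integral_add' hPi hL, EReal.coe_add,
      integral_eq_lintegral_of_nonneg_ae (Filter.Eventually.of_forall hP)
        hPm.aestronglyMeasurable, EReal.coe_ennreal_toReal htop]

theorem _root_.ConvexOn.add_fderiv_le {E : Type*} [NormedAddCommGroup E] [NormedSpace ℝ E]
    {F : E → ℝ} (hF : ConvexOn ℝ Set.univ F) {x : E} (hd : DifferentiableAt ℝ F x) (v : E) :
    F x + fderiv ℝ F x v ≤ F (x + v) := by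
  have hc : ConvexOn ℝ Set.univ (F ∘ AffineMap.lineMap (k := ℝ) x (x + v)) :=
    hF.comp_affineMap (AffineMap.lineMap x (x + v))
  have h0 : HasDerivAt (AffineMap.lineMap (k := ℝ) x (x + v)) v 0 := by
    simpa using AffineMap.hasDerivAt_lineMap (a := x) (b := x + v) (x := (0 : ℝ))
  have hd' : HasFDerivAt F (fderiv ℝ F x) (AffineMap.lineMap (k := ℝ) x (x + v) 0) := by
    rw [AffineMap.lineMap_apply_zero]
    exact hd.hasFDerivAt
  have h1 := hd'.comp_hasDerivAt (0 : ℝ) h0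
  have h2 := hc.deriv_le_slope (Set.mem_univ 0) (Set.mem_univ 1) one_pos h1.differentiableAt
  rw [h1.deriv, slope_def_field] at h2
  simp only [Function.comp_apply, AffineMap.lineMap_apply_zero, AffineMap.lineMap_apply_one,
    sub_zero, div_one] at h2
  linarith

/-- Loop weights are irrelevant: trees have no loops, and cosh 0 - 1 = 0. -/
theorem tField_congr {W W' : Weights N} (h : ∀ a b, a ≠ b → W s(a, b) = W' s(a, b)) :
    tField W = tField W' := by
  have h1 : ∀ t, treeSum W t = treeSum W' t := by
    classical
    intro t
    rw [treeSum, treeSum]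
    refine Finset.sum_congr rfl fun T _ => Finset.prod_congr rfl fun e he => ?_
    have he := (Finset.mem_filter.1 he).2
    induction e using Sym2.ind with
    | _ a b => rw [edgeFactor, edgeFactor, h a b he.ne]
  have h2 : density W = density W' := by
    ext t
    rw [density, density, h1]
    congr 5
    refine Finset.sum_congr rfl fun a _ => Finset.sum_congr rfl fun b _ => ?_
    rcases eq_or_ne a b with rfl | hab
    · simp
    · rw [h a b hab]
  rw [tField, tField, h2]

/-- Affine test functions are both convex and concave, so the two inequalities meet. -/
theorem EdgeMonotone.integral_eq {p q : Vertex N} (h : EdgeMonotone N p q) {W W' : Weights N}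
    (hW : W.IsPositive) (hW' : W'.IsPositive) (hs : ∀ e, e ≠ s(p, q) → W e = W' e)
    (hle : W s(p, q) ≤ W' s(p, q)) {F : (Fin N → ℝ) → ℝ} (hFm : Measurable F)
    (hF0 : ∀ x ∈ orthant N, 0 ≤ F x) (h1 : ConvexOn ℝ (orthant N) F)
    (h2 : ConcaveOn ℝ (orthant N) F) :
    ∫ t, F (expField t) ∂tField W = ∫ t, F (expField t) ∂tField W' := by
  obtain ⟨ha, hb⟩ := h W W' hW hW' hs hle F hFm hF0
  have hm : Measurable fun t => F (expField t) := hFm.comp continuous_expField.measurable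
  rw [integral_eq_lintegral_of_nonneg_ae
      (Filter.Eventually.of_forall fun t => hF0 _ (expField_mem t)) hm.aestronglyMeasurable,
    integral_eq_lintegral_of_nonneg_ae
      (Filter.Eventually.of_forall fun t => hF0 _ (expField_mem t)) hm.aestronglyMeasurable,
    le_antisymm (hb h2) (ha h1)]

theorem integrable_affine {W : Weights N} (hW : W.IsPositive) (c : ℝ) (l : Fin N → ℝ) :
    Integrable (fun t => c + ∑ k, l k * expField t k) (tField W) := by
  have h := (integrable_one hW).const_mul c
  simp only [mul_one] at h
  exact h.add (integrable_finsetSum _ fun k _ => (integrable_expField hW k).const_mul (l k))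

/-- The expectation of an affine function does not depend on the weights. -/
theorem EdgeMonotone.integral_affine_eq {p q : Vertex N} (h : EdgeMonotone N p q)
    {W W' : Weights N} (hW : W.IsPositive) (hW' : W'.IsPositive)
    (hs : ∀ e, e ≠ s(p, q) → W e = W' e) (hle : W s(p, q) ≤ W' s(p, q)) (c : ℝ)
    (l : Fin N → ℝ) :
    ∫ t, (c + ∑ k, l k * expField t k) ∂tField W =
      ∫ t, (c + ∑ k, l k * expField t k) ∂tField W' := by
  have key : ∀ U : Weights N, U.IsPositive → ∫ t, (c + ∑ k, l k * expField t k) ∂tField U =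
      c * ∫ _, (1 : ℝ) ∂tField U + ∑ k, l k * ∫ t, expField t k ∂tField U := by
    intro U hU
    have h1 := (integrable_one hU).const_mul c
    simp only [mul_one] at h1
    rw [integral_add h1
      (integrable_finsetSum _ fun k _ => (integrable_expField hU k).const_mul (l k)),
      integral_finsetSum _ fun k _ => (integrable_expField hU k).const_mul (l k),
      ← integral_const_mul]
    simp only [mul_one, integral_const_mul]
  rw [key W hW, key W' hW',
    h.integral_eq hW hW' hs hle (F := fun _ => 1) measurable_const (fun _ _ => zero_le_one)
      (convexOn_const _ convex_orthant) (concaveOn_const _ convex_orthant)]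
  congr 1
  refine Finset.sum_congr rfl fun k _ => ?_
  rw [h.integral_eq hW hW' hs hle (F := fun x => x k) (measurable_pi_apply k)
      (fun x hx => (hx k).le)
      ((LinearMap.proj (R := ℝ) (φ := fun _ : Fin N => ℝ) k).convexOn convex_orthant)
      ((LinearMap.proj (R := ℝ) (φ := fun _ : Fin N => ℝ) k).concaveOn convex_orthant)]

/-- A smooth convex function is the sum of a nonnegative convex function and an affine one. -/
theorem exists_affine_minorant {F : (Fin N → ℝ) → ℝ} (hF : ContDiff ℝ ∞ F)
    (hconv : ConvexOn ℝ Set.univ F) : ∃ (c : ℝ) (l : Fin N → ℝ),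
      (∀ x, 0 ≤ F x - (c + ∑ k, l k * x k)) ∧
        ConvexOn ℝ (orthant N) (fun x => F x - (c + ∑ k, l k * x k)) := by
  have hd : DifferentiableAt ℝ F 0 := hF.differentiable (by simp) 0
  have hsum : ∀ x, fderiv ℝ F 0 x = ∑ k, fderiv ℝ F 0 (Pi.single k 1) * x k := by
    intro x
    conv_lhs => rw [← Finset.univ_sum_single x, map_sum]
    refine Finset.sum_congr rfl fun k _ => ?_
    rw [mul_comm, ← smul_eq_mul, ← map_smul, ← Pi.single_smul, smul_eq_mul, mul_one]
  -- The affine function is the tangent at the origin, which lies outside the orthant when N ≥ 1 but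
  -- inside the domain of convexity of F.
  refine ⟨F 0, fun k => fderiv ℝ F 0 (Pi.single k 1), fun x => ?_, ?_⟩
  · have h := hconv.add_fderiv_le hd x
    rw [zero_add] at h
    rw [← hsum]
    linarith
  · simp only [← hsum]
    refine (hconv.subset (Set.subset_univ _) convex_orthant).sub ?_
    exact (concaveOn_const _ convex_orthant).add
      ((fderiv ℝ F 0).toLinearMap.concaveOn convex_orthant)

theorem EdgeMonotone.extIntegral_le {p q : Vertex N} (h : EdgeMonotone N p q)
    {W W' : Weights N} (hW : W.IsPositive) (hW' : W'.IsPositive)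
    (hs : ∀ e, e ≠ s(p, q) → W e = W' e) (hle : W s(p, q) ≤ W' s(p, q))
    {F : (Fin N → ℝ) → ℝ} (hF : ContDiff ℝ ∞ F) (hconv : ConvexOn ℝ Set.univ F) :
    extIntegral (tField W') (fun t => F (expField t)) ≤
      extIntegral (tField W) (fun t => F (expField t)) := by
  obtain ⟨c, l, h0, hc⟩ := exists_affine_minorant hF hconv
  set P : (Fin N → ℝ) → ℝ := fun x => F x - (c + ∑ k, l k * x k) with hP
  have hPm : Measurable P := by
    have := hF.continuous.measurable
    fun_prop
  have hPe : Measurable fun t => P (expField t) := hPm.comp continuous_expField.measurable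
  have hdec : (fun t => F (expField t)) =
      fun t => P (expField t) + (c + ∑ k, l k * expField t k) := by
    ext t
    rw [hP]
    ring
  rw [hdec, extIntegral_add hPe (fun t => h0 _) (integrable_affine hW c l),
    extIntegral_add hPe (fun t => h0 _) (integrable_affine hW' c l),
    h.integral_affine_eq hW hW' hs hle c l]
  refine add_le_add_left ?_ _
  exact EReal.coe_ennreal_le_coe_ennreal_iff.2
    ((h W W' hW hW' hs hle P hPm fun x _ => h0 x).1 hc)

end H22

end

/-! ### Conclusion: the negative part and monotonicity in every edge weight. -/

theorem mainTheorem1 (N : ℕ) (hN : 1 ≤ N)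
    (F : (Fin N → ℝ) → ℝ) (hF : ContDiff ℝ ∞ F) (hconv : ConvexOn ℝ Set.univ F) :
    (∀ W : H22.Weights N, W.IsPositive →
      ∫⁻ t, ENNReal.ofReal (-F (fun k => Real.exp (t k))) ∂(H22.tField W) ≠ ⊤) ∧
    ∀ W : H22.Weights N, W.IsPositive → ∀ i j : H22.Vertex N,
      AntitoneOn
        (fun w : ℝ => H22.extIntegral (H22.tField (Function.update W s(i, j) w))
          (fun t => F (fun k => Real.exp (t k))))
        (Set.Ioi 0) := by
  refine ⟨fun W hW => ?_, fun W hW i j v hv w hw hvw => ?_⟩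
  · obtain ⟨c, l, h0, -⟩ := H22.exists_affine_minorant hF hconv
    refine ((lintegral_mono fun t => ENNReal.ofReal_le_ofReal ?_).trans_lt
      (H22.integrable_affine hW c l).neg.lintegral_lt_top).ne
    have := h0 (H22.expField t)
    simp only [Pi.neg_apply]
    change -F (H22.expField t) ≤ _
    linarith
  -- For i = j the weight is that of a loop and the integral is constant in it.
  · rcases eq_or_ne i j with rfl | hij
    · have h : ∀ u, H22.tField (Function.update W s(i, i) u) = H22.tField W := fun u =>
        H22.tField_congr fun a b hab => Function.update_of_ne
          (fun h => by rcases Sym2.eq_iff.1 h with ⟨rfl, rfl⟩ | ⟨rfl, rfl⟩ <;> exact hab rfl) _ _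
      simp only [h, le_refl]
    · obtain ⟨n, rfl⟩ : ∃ n, N = n + 1 := ⟨N - 1, by omega⟩
      have hpos : ∀ u : ℝ, 0 < u →
          H22.Weights.IsPositive (Function.update W s(i, j) u) := fun u hu a b hab => by
        rw [Function.update_apply]
        split_ifs
        · exact hu
        · exact hW a b hab
      refine (H22.edgeMonotone_of_ne hij).extIntegral_le (hpos v hv) (hpos w hw)
        (fun e he => ?_) ?_ hF hconv
      · rw [Function.update_of_ne he, Function.update_of_ne he]
      · rwa [Function.update_self, Function.update_self]
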